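/- **Proposition 1 (finite-time identification of active and inactive constraints).** *Setting.* Let $\mathbb P$ be a probability distribution on $\mathbb R^r$, let $F:\mathbb R^s\times\mathbb R^r\to\mathbb R$, and let $\Theta=\{\theta\in\mathbb R^s: A\theta\le b\}$ and $\mathcal M=\{\mu\in\mathbb R^m: C\mu\le d\}$ be polyhedra. Let $G(\theta,x)=\nabla_\theta F(\theta,x)$ and $f(\theta)=\mathbb E_{X\sim\mathbb P}[F(\theta,X)]$ for $\theta\in\Theta$, with $\nabla f(\theta)=\mathbb E_{X\sim\mathbb P}[G(\theta,X)]$. Let $(\mathbb P_\mu)_{\mu\in\mathcal M}$ be a family of probability distributions with $\mathbb P\ll\mathbb P_\mu$ and likelihood ratio $\ell(x,\mu)=\frac{d\mathbb P}{d\mathbb P_\mu}(x)$, such that for every $x$ the function $\mu\mapsto\ell(x,\mu)$ is logarithmically convex and differentiable on $\mathcal M$. Write $G_\mu(\theta,x)=\ell(x,\mu)G(\theta,x)$. For a point $\theta$ let $\mathrm P_{A_a^\theta}$ be the orthogonal projector onto the null space of the rows of $A$ that are active at $\theta$, and put $$V(\theta,\mu,x)=\|\mathrm P_{A_a^\theta}G(\theta,x)\|^2\ell(x,\mu),\quad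 v(\theta,\mu)=\mathbb E_{X\sim\mathbb P}[V(\theta,\mu,X)],\quad H(\theta,\mu,x)=\|\mathrm P_{A_a^\theta}G(\theta,x)\|^2\nabla_\mu\ell(x,\mu),$$ so that $\nabla_\mu v(\theta,\mu)=\mathbb E_{X\sim\mathbb P}[H(\theta,\mu,X)]$. For points $\theta^\star\in\Theta$, $\mu^\star\in\mathcal M$ let $(A_a^\star,b_a^\star)$, $(A_i^\star,b_i^\star)$ be the rows of $(A,b)$ that are active, respectively inactive, at $\theta^\star$, and $(C_a^\star,d_a^\star)$, $(C_i^\star,d_i^\star)$ the rows of $(C,d)$ that are active, respectively inactive, at $\mu^\star$. *Assumptions.* 1. (Stochastic optimization) $f$ is convex and continuously differentiable on $\Theta$ and twice continuously differentiable near $\theta^\star$; $\theta^\star$ is the unique minimizer of $f$ over $\Theta$ and $\nabla^2f(\theta^\star)$ is positive definite; $\Theta$ is bounded. 2. (Importance sampling) $\mu^\star$ is the unique minimizer of $v(\theta^\star,\cdot)$ over $\mathcal M$ and $\nabla^2_\mu v(\theta^\star,\mu^\star)$ is positive definite; $\mathcal M$ is bounded; there are finite $G_M,H_M$ such that for all $\theta\in\Theta$,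 $\mu\in\mathcal M$: $\mathbb E_{X\sim\mathbb P}[\|G(\theta,X)\|^2\ell(X,\mu)]\le G_M^2$ and $\mathbb E_{X\sim\mathbb P}[\|\mathrm P_{A_a^\theta}G(\theta,X)\|^4\|\nabla_\mu\ell(X,\mu)\|^2]\le H_M^2$. 3. (Regularity) There are $c_1>0$ and $c_2,c_3<\infty$ such that for all $\theta\in\Theta$, $\mu\in\mathcal M$: $f(\theta)-f(\theta^\star)\ge c_1\|\theta-\theta^\star\|^2$; $v(\theta^\star,\mu)-v(\theta^\star,\mu^\star)\ge c_1\|\mu-\mu^\star\|^2$; $\|\nabla f(\theta)-\nabla f(\theta^\star)\|\le c_2\|\theta-\theta^\star\|$; $\|\nabla_\mu v(\theta^\star,\mu)-\nabla_\mu v(\theta^\star,\mu^\star)\|\le c_2\|\mu-\mu^\star\|$; and, whenever in addition $A_a^\star\theta=b_a^\star$ and $A_i^\star\theta<b_i^\star$, $\|\nabla_\mu v(\theta,\mu)-\nabla_\mu v(\theta^\star,\mu)\|\le c_3\|\theta-\theta^\star\|^2$. 4. (Strict complementarity) $-\nabla f(\theta^\star)=A_a^{\star\top}\lambda_1$ and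 $-\nabla_\mu v(\theta^\star,\mu^\star)=C_a^{\star\top}\lambda_2$ for some vectors $\lambda_1,\lambda_2$ with strictly positive entries. *Iteration.* Let $\alpha>0$, $\gamma\in(1/2,1)$, $\alpha_n=\alpha/n^\gamma$, $\theta_0\in\mathbb R^s$, $\mu_0\in\mathcal M$. Let $\mathcal F_n$ be a filtration containing the samples $X_k^{(\mu_{k-1})},X_k$, $1\le k\le n$, of the first $n$ rounds, and suppose that, conditionally on $\mathcal F_n$, $X_{n+1}^{(\mu_n)}$ has law $\mathbb P_{\mu_n}$ and $X_{n+1}$ has law $\mathbb P$. For $n\ge0$ let $$(\theta_{n+1},\mu_{n+1})=\operatorname*{arg\,min}_{(\theta,\mu)\in\Theta\times\mathcal M}\Big\{\Big\langle\sum_{k=0}^n\alpha_{k+1}G_{\mu_k}(\theta_k,X_{k+1}^{(\mu_k)}),\theta\Big\rangle+\Big\langle\sum_{k=0}^n\alpha_{k+1}H(\theta_k,\mu_k,X_{k+1}),\mu\Big\rangle+\tfrac12\|\theta-\theta_0\|^2+\tfrac12\|\mu-\mu_0\|^2\Big\}.$$ *Conclusion.* There is a random variable $N$ with values in $\mathbb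 N$ such that, almost surely, for all $n\ge N$, $$A_a^\star\theta_n=b_a^\star,\qquad A_i^\star\theta_n<b_i^\star,\qquad C_a^\star\mu_n=d_a^\star,\qquad C_i^\star\mu_n<d_i^\star .$$ -/

import Mathlib

open MeasureTheory ProbabilityTheory Set Filter Topology
open scoped Matrix

noncomputable section

namespace AdaptiveIS

/-- Euclidean space `ℝⁿ`. -/
abbrev Vec (n : ℕ) : Type := EuclideanSpace ℝ (Fin n)

/-! ### Polyhedra, active constraints -/

/-- The polyhedron `{x | A x ≤ b}`. -/
def polyhedron {p n : ℕ} (A : Matrix (Fin p) (Fin n) ℝ) (b : Fin p → ℝ) : Set (Vec n) :=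
  {x | ∀ i, (A *ᵥ x.ofLp) i ≤ b i}

/-- The `i`-th constraint of `A x ≤ b` is active at `x`. -/
def IsActive {p n : ℕ} (A : Matrix (Fin p) (Fin n) ℝ) (b : Fin p → ℝ) (x : Vec n)
    (i : Fin p) : Prop :=
  (A *ᵥ x.ofLp) i = b i

/-- The null space `{w | A_a^x w = 0}` of the rows of `A` that are active at `x`. -/
def activeNullSpace {p n : ℕ} (A : Matrix (Fin p) (Fin n) ℝ) (b : Fin p → ℝ) (x : Vec n) :
    Submodule ℝ (Vec n) where
  carrier := {w | ∀ i, IsActive A b x i → (A *ᵥ w.ofLp) i = 0}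
  add_mem' := by
    intro u w hu hw i hi
    simp [Matrix.mulVec_add, hu i hi, hw i hi]
  zero_mem' := by
    intro i _
    simp
  smul_mem' := by
    intro c w hw i hi
    simp [Matrix.mulVec_smul, hw i hi]

/-- The orthogonal projector onto the null space of the constraints active at `x`. -/
def activeProj {p n : ℕ} (A : Matrix (Fin p) (Fin n) ℝ) (b : Fin p → ℝ) (x : Vec n) :
    Vec n →L[ℝ] Vec n :=
  (activeNullSpace A b x).starProjection

/-- `x` satisfies with equality every constraint that is active at `xs`, and strictly every
constraint that is inactive (slack) at `xs`. -/
def SatisfiesPattern {p n : ℕ} (A : Matrix (Fin p) (Fin n) ℝ) (b : Fin p → ℝ)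
    (xs x : Vec n) : Prop :=
  (∀ i, (A *ᵥ xs.ofLp) i = b i → (A *ᵥ x.ofLp) i = b i) ∧
    (∀ i, (A *ᵥ xs.ofLp) i < b i → (A *ᵥ x.ofLp) i < b i)

/-- `g = A_aᵀ lam` for a strictly positive multiplier `lam` of the constraints active at `x`
(the multiplier is extended by zero to the inactive constraints). -/
def HasStrictMultiplier {p n : ℕ} (A : Matrix (Fin p) (Fin n) ℝ) (b : Fin p → ℝ)
    (x g : Vec n) : Prop :=
  ∃ lam : Fin p → ℝ, (∀ i, IsActive A b x i → 0 < lam i) ∧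
    (∀ i, ¬ IsActive A b x i → lam i = 0) ∧ g.ofLp = Aᵀ *ᵥ lam

/-! ### Optimization notions -/

/-- `x` is the unique minimizer of `h` over `S`. -/
def IsUniqueMinimizer {E : Type*} (h : E → ℝ) (S : Set E) (x : E) : Prop :=
  x ∈ S ∧ ∀ y ∈ S, y ≠ x → h x < h y

/-- The operator is symmetric positive definite. -/
def IsSymmPosDef {n : ℕ} (T : Vec n →L[ℝ] Vec n) : Prop :=
  (∀ u w, inner ℝ (T u) w = inner ℝ u (T w)) ∧ ∀ w, w ≠ 0 → 0 < inner ℝ w (T w)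

/-! ### Data of the two coupled problems -/

/-- The data: constraints `A θ ≤ b` and `C μ ≤ d`; the law `P` on `ℝʳ`; the cost `F` and its
stochastic gradient `G`; the importance sampling family `μ ↦ Q μ`; its likelihood ratio
`ell x μ = (dP/dQ_μ)(x)` and the gradient `gradEll x μ` of the latter in `μ`.
The properties that tie these together are in `Data.IsModel` and `Data.Assumption...`. -/
structure Data (s r m p q : ℕ) where
  A : Matrix (Fin p) (Fin s) ℝ
  b : Fin p → ℝ
  C : Matrix (Fin q) (Fin m) ℝ
  d : Fin q → ℝ
  P : Measure (Vec r)
  F : Vec s → Vec r → ℝ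
  G : Vec s → Vec r → Vec s
  Q : Kernel (Vec m) (Vec r)
  ell : Vec r → Vec m → ℝ
  gradEll : Vec r → Vec m → Vec m

namespace Data

variable {s r m p q : ℕ} (D : Data s r m p q)

/-- The feasible set `Θ` of the decision. -/
def Theta : Set (Vec s) := polyhedron D.A D.b

/-- The feasible set of the importance sampling parameter. -/
def M : Set (Vec m) := polyhedron D.C D.d

/-- The objective `f(θ) = E_P[F(θ, X)]`. -/
def f (θ : Vec s) : ℝ := ∫ x, D.F θ x ∂D.P

/-- `∇f(θ) = E_P[G(θ, X)]`. -/
def gradf (θ : Vec s) : Vec s := ∫ x, D.G θ x ∂D.P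

/-- `G_μ(θ, x) = ell(x, μ) G(θ, x)`. -/
def Gis (θ : Vec s) (μ : Vec m) (x : Vec r) : Vec s := D.ell x μ • D.G θ x

/-- `V(θ, μ, x) = ‖P_{A_a^θ} G(θ, x)‖² ell(x, μ)`. -/
def V (θ : Vec s) (μ : Vec m) (x : Vec r) : ℝ :=
  ‖activeProj D.A D.b θ (D.G θ x)‖ ^ 2 * D.ell x μ

/-- `v(θ, μ) = E_P[V(θ, μ, X)]`. -/
def v (θ : Vec s) (μ : Vec m) : ℝ := ∫ x, D.V θ μ x ∂D.P

/-- `H(θ, μ, x) = ‖P_{A_a^θ} G(θ, x)‖² ∇_μ ell(x, μ)`. -/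
def H (θ : Vec s) (μ : Vec m) (x : Vec r) : Vec m :=
  ‖activeProj D.A D.b θ (D.G θ x)‖ ^ 2 • D.gradEll x μ

/-- `∇_μ v(θ, μ) = E_P[H(θ, μ, X)]`. -/
def gradv (θ : Vec s) (μ : Vec m) : Vec m := ∫ x, D.H θ μ x ∂D.P

/-- The standing conventions that give the data their meaning: `P` and all `Q μ` are probability
measures, `F(θ, X)` is integrable on `Θ`, `G = ∇_θ F`, `ell(·, μ)` is a (nonnegative) version of
the Radon-Nikodym derivative `dP/dQ_μ`, and everything is measurable.
Only the `Q μ` with `μ` in the parameter set ever matter. -/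
structure IsModel : Prop where
  probP : IsProbabilityMeasure D.P
  markovQ : IsMarkovKernel D.Q
  integrable_F : ∀ θ ∈ D.Theta, Integrable (D.F θ) D.P
  gradient_F : ∀ θ ∈ D.Theta, ∀ᵐ x ∂D.P, HasGradientAt (fun θ' => D.F θ' x) (D.G θ x) θ
  measurable_G : Measurable (fun z : Vec s × Vec r => D.G z.1 z.2)
  ell_nonneg : ∀ μ ∈ D.M, ∀ x, 0 ≤ D.ell x μ
  ell_density : ∀ μ ∈ D.M, D.P = (D.Q μ).withDensity (fun x => ENNReal.ofReal (D.ell x μ))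
  measurable_ell : Measurable (fun z : Vec r × Vec m => D.ell z.1 z.2)
  measurable_gradEll : Measurable (fun z : Vec r × Vec m => D.gradEll z.1 z.2)

/-- Stochastic optimization: convexity, continuous differentiability on `Θ` (with
`∇f = E_P[G(·, X)]`), a Hessian near `θs` that is continuous and positive definite at `θs`,
a unique minimizer `θs`, and boundedness of `Θ`. The derivatives are relative to `Θ`, on which
`f` lives. -/
structure AssumptionSO (θs : Vec s) : Prop where
  convex : ConvexOn ℝ D.Theta D.f
  gradient : ∀ θ ∈ D.Theta, HasGradientWithinAt D.f (D.gradf θ) D.Theta θ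
  gradient_continuous : ContinuousOn D.gradf D.Theta
  hessian : ∃ U ∈ 𝓝 θs, ∃ Hf : Vec s → (Vec s →L[ℝ] Vec s),
    (∀ θ ∈ U ∩ D.Theta, HasFDerivWithinAt D.gradf (Hf θ) D.Theta θ) ∧
      ContinuousOn Hf (U ∩ D.Theta) ∧ IsSymmPosDef (Hf θs)
  unique_minimizer : IsUniqueMinimizer D.f D.Theta θs
  bounded : Bornology.IsBounded D.Theta

/-- Importance sampling class: `μ ↦ ell(x, μ)` is logarithmically convex and differentiable. -/
structure AssumptionISClass : Prop where
  log_convex : ∀ x, ∀ μ₁ ∈ D.M, ∀ μ₂ ∈ D.M, ∀ t₁ t₂ : ℝ, 0 < t₁ → 0 < t₂ → t₁ + t₂ = 1 →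
    D.ell x (t₁ • μ₁ + t₂ • μ₂) ≤ D.ell x μ₁ ^ t₁ * D.ell x μ₂ ^ t₂
  differentiable : ∀ x, ∀ μ ∈ D.M,
    HasGradientWithinAt (fun μ' => D.ell x μ') (D.gradEll x μ) D.M μ

/-- Importance sampling problem: unique minimizer `μs` of `v(θs, ·)` with positive definite
Hessian, bounded parameter set, and uniform second moment bounds of the stochastic gradients. -/
structure AssumptionIS (θs : Vec s) (μs : Vec m) : Prop where
  unique_minimizer : IsUniqueMinimizer (D.v θs) D.M μs
  hessian : ∃ Hv : Vec m →L[ℝ] Vec m,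
    HasFDerivWithinAt (D.gradv θs) Hv D.M μs ∧ IsSymmPosDef Hv
  bounded : Bornology.IsBounded D.M
  moment_G : ∃ GM : ℝ, ∀ θ ∈ D.Theta, ∀ μ ∈ D.M,
    Integrable (fun x => ‖D.G θ x‖ ^ 2 * D.ell x μ) D.P ∧
      ∫ x, ‖D.G θ x‖ ^ 2 * D.ell x μ ∂D.P ≤ GM ^ 2
  moment_H : ∃ HM : ℝ, ∀ θ ∈ D.Theta, ∀ μ ∈ D.M,
    Integrable (fun x => ‖activeProj D.A D.b θ (D.G θ x)‖ ^ 4 * ‖D.gradEll x μ‖ ^ 2) D.P ∧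
      ∫ x, ‖activeProj D.A D.b θ (D.G θ x)‖ ^ 4 * ‖D.gradEll x μ‖ ^ 2 ∂D.P ≤ HM ^ 2

/-- Regularity: quadratic growth of both objectives, Lipschitz-type bounds of the gradients at
the optima, the quadratic bound on `∇_μ v(θ, μ) - ∇_μ v(θs, μ)` for those `θ` that have the same
active constraints as `θs`, and strict complementarity at `θs`. -/
structure AssumptionRegularity (θs : Vec s) (μs : Vec m) : Prop where
  growth : ∃ c₁ : ℝ, 0 < c₁ ∧
    (∀ θ ∈ D.Theta, c₁ * ‖θ - θs‖ ^ 2 ≤ D.f θ - D.f θs) ∧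
    (∀ μ ∈ D.M, c₁ * ‖μ - μs‖ ^ 2 ≤ D.v θs μ - D.v θs μs)
  lipschitz : ∃ c₂ : ℝ,
    (∀ θ ∈ D.Theta, ‖D.gradf θ - D.gradf θs‖ ≤ c₂ * ‖θ - θs‖) ∧
    (∀ μ ∈ D.M, ‖D.gradv θs μ - D.gradv θs μs‖ ≤ c₂ * ‖μ - μs‖)
  coupling : ∃ c₃ : ℝ, ∀ μ ∈ D.M, ∀ θ ∈ D.Theta, SatisfiesPattern D.A D.b θs θ →
    ‖D.gradv θ μ - D.gradv θs μ‖ ≤ c₃ * ‖θ - θs‖ ^ 2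
  multiplier : HasStrictMultiplier D.A D.b θs (-D.gradf θs)

/-- Strict complementarity for both problems. -/
structure AssumptionStrictCompl (θs : Vec s) (μs : Vec m) : Prop where
  multiplier_θ : HasStrictMultiplier D.A D.b θs (-D.gradf θs)
  multiplier_μ : HasStrictMultiplier D.C D.d μs (-D.gradv θs μs)

/-- `(θ n, μ n)` are the iterates of the joint dual averaging scheme with step sizes
`α_{k+1} = step k`, initial point `(θ₀, μ₀)` and samples `Y k = X_{k+1}^{(μ_k)}`,
`Z k = X_{k+1}`: given the information `ℱ k` available after `k` rounds (which contains the
samples of these rounds), `Y k` has law `Q (μ k)` and `Z k` has law `P`. -/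
structure IsIteration {Ω : Type*} [mΩ : MeasurableSpace Ω] (Pr : Measure Ω)
    (ℱ : Filtration ℕ mΩ) (step : ℕ → ℝ) (θ₀ : Vec s) (μ₀ : Vec m)
    (Y Z : ℕ → Ω → Vec r) (θ : ℕ → Ω → Vec s) (μ : ℕ → Ω → Vec m) : Prop where
  measurable_Y : ∀ k, Measurable[ℱ (k + 1)] (Y k)
  measurable_Z : ∀ k, Measurable[ℱ (k + 1)] (Z k)
  law_Y : ∀ k, ∀ B : Set (Vec r), MeasurableSet B →
    Pr⟦Y k ⁻¹' B | ℱ k⟧ =ᵐ[Pr] fun ω => (D.Q (μ k ω)).real B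
  law_Z : ∀ k, ∀ B : Set (Vec r), MeasurableSet B →
    Pr⟦Z k ⁻¹' B | ℱ k⟧ =ᵐ[Pr] fun _ => D.P.real B
  init : ∀ ω, θ 0 ω = θ₀ ∧ μ 0 ω = μ₀
  mem_step : ∀ n ω, (θ (n + 1) ω, μ (n + 1) ω) ∈ D.Theta ×ˢ D.M
  argmin_step : ∀ n ω, IsMinOn
    (fun z : Vec s × Vec m =>
      inner ℝ (∑ k ∈ Finset.range (n + 1), step k • D.Gis (θ k ω) (μ k ω) (Y k ω)) z.1 +
      inner ℝ (∑ k ∈ Finset.range (n + 1), step k • D.H (θ k ω) (μ k ω) (Z k ω)) z.2 +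
      1 / 2 * (‖z.1 - θ₀‖ ^ 2 + ‖z.2 - μ₀‖ ^ 2))
    (D.Theta ×ˢ D.M) (θ (n + 1) ω, μ (n + 1) ω)

end Data

end AdaptiveIS

end

namespace AdaptiveIS

section Projection

variable {E : Type*} [NormedAddCommGroup E] [InnerProductSpace ℝ E]

/-- `x` is the metric projection of `z` onto `K`, by its variational characterization. -/
def IsProj (K : Set E) (z x : E) : Prop :=
  x ∈ K ∧ ∀ w ∈ K, inner ℝ (z - x) (w - x) ≤ 0

/-- The Fenchel coupling of `u` with the dual variable `z` whose projection is `x`. -/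
noncomputable def coupling (u z x : E) : ℝ := ‖u - z‖ ^ 2 / 2 - ‖x - z‖ ^ 2 / 2

lemma coupling_eq (u z x : E) :
    coupling u z x = ‖x - u‖ ^ 2 / 2 - inner ℝ (z - x) (u - x) := by
  have h : u - z = (x - z) - (x - u) := by abel
  have h1 : z - x = -(x - z) := by abel
  have h2 : u - x = -(x - u) := by abel
  rw [coupling, h, norm_sub_sq_real, h1, h2, inner_neg_neg]
  ring

lemma IsProj.coupling_ge {K : Set E} {u z x : E} (h : IsProj K z x) (hu : u ∈ K) :
    ‖x - u‖ ^ 2 / 2 ≤ coupling u z x := by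
  rw [coupling_eq]
  linarith [h.2 u hu]

lemma IsProj.coupling_sub_le {K : Set E} {u z x x' g : E} (h : IsProj K z x)
    (h' : IsProj K (z - g) x') :
    coupling u (z - g) x' ≤ coupling u z x - inner ℝ g (x - u) + ‖g‖ ^ 2 / 2 := by
  have h1 := h.2 x' h'.1
  have e1 : u - (z - g) = (u - z) + g := by abel
  have e2 : x' - (z - g) = (x - z) + ((x' - x) + g) := by abel
  have e3 : z - x = -(x - z) := by abel
  have e4 : inner ℝ g (x - u) = inner ℝ (x - z) g - inner ℝ (u - z) g := by
    rw [← inner_sub_left, real_inner_comm, sub_sub_sub_cancel_right]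
  rw [e3, inner_neg_left] at h1
  rw [coupling, coupling, e1, e2, norm_add_sq_real, norm_add_sq_real (x - z), inner_add_right, e4]
  nlinarith [sq_nonneg ‖x' - x + g‖]

lemma IsProj.norm_sub_le {K : Set E} {z z' x x' : E} (h : IsProj K z x) (h' : IsProj K z' x') :
    ‖x - x'‖ ≤ ‖z - z'‖ := by
  have h1 := h.2 x' h'.1
  have h2 := h'.2 x h.1
  have e : inner ℝ (z - x) (x' - x) + inner ℝ (z' - x') (x - x')
      = ‖x - x'‖ ^ 2 - inner ℝ (z - z') (x - x') := by
    have e1 : x' - x = -(x - x') := by abel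
    rw [e1, inner_neg_right, ← real_inner_self_eq_norm_sq, neg_add_eq_sub, ← inner_sub_left,
      ← inner_sub_left]
    congr 1; abel
  have h3 := real_inner_le_norm (z - z') (x - x')
  by_contra! hlt
  have := norm_nonneg (z - z')
  nlinarith [norm_nonneg (x - x')]

lemma IsProj.unique {K : Set E} {z x x' : E} (h : IsProj K z x) (h' : IsProj K z x') :
    x = x' := by
  have := h.norm_sub_le h'
  rw [sub_self, norm_zero, norm_le_zero_iff, sub_eq_zero] at this
  exact this

lemma IsProj.of_forall_norm_le {K : Set E} (hK : Convex ℝ K) {z x : E} (hx : x ∈ K)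
    (h : ∀ w ∈ K, ‖x - z‖ ^ 2 ≤ ‖w - z‖ ^ 2) : IsProj K z x := by
  refine ⟨hx, fun w hw => ?_⟩
  by_contra! hpos
  set c := inner ℝ (z - x) (w - x) with hc
  have key : ∀ t : ℝ, 0 < t → t ≤ 1 → 2 * c ≤ t * ‖w - x‖ ^ 2 := by
    intro t ht ht1
    have hm : x + t • (w - x) ∈ K := hK.add_smul_sub_mem hx hw ⟨ht.le, ht1⟩
    have h1 := h _ hm
    have e : x + t • (w - x) - z = -(z - x) + t • (w - x) := by abel
    have e' : x - z = -(z - x) := by abel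
    rw [e, e', norm_add_sq_real, inner_neg_left, inner_smul_right, norm_smul, ← hc, mul_pow,
      Real.norm_eq_abs, sq_abs] at h1
    have : t * (2 * c) ≤ t * (t * ‖w - x‖ ^ 2) := by nlinarith
    exact le_of_mul_le_mul_left this ht
  have hlim : Tendsto (fun t : ℝ => t * ‖w - x‖ ^ 2) (𝓝[>] 0) (𝓝 (0 * ‖w - x‖ ^ 2)) :=
    ((continuous_id.mul continuous_const).tendsto 0).mono_left nhdsWithin_le_nhds
  have : 2 * c ≤ 0 * ‖w - x‖ ^ 2 := by
    refine ge_of_tendsto hlim ?_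
    filter_upwards [Ioc_mem_nhdsGT (zero_lt_one' ℝ)] with t ht using key t ht.1 ht.2
  linarith

lemma exists_continuous_proj [CompleteSpace E] {K : Set E} (hc : Convex ℝ K) (hcl : IsClosed K)
    (hne : K.Nonempty) : ∃ π : E → E, Continuous π ∧ ∀ z, IsProj K z (π z) := by
  have h : ∀ z, ∃ x, IsProj K z x := fun z => by
    obtain ⟨x, hx, hx'⟩ := exists_norm_eq_iInf_of_complete_convex hne hcl.isComplete hc z
    exact ⟨x, hx, (norm_eq_iInf_iff_real_inner_le_zero hc hx).1 hx'⟩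
  choose π hπ using h
  refine ⟨π, LipschitzWith.continuous (K := 1) (LipschitzWith.of_dist_le_mul fun z z' => ?_), hπ⟩
  simpa [dist_eq_norm] using (hπ z).norm_sub_le (hπ z')

end Projection

section Polyhedron

variable {p n : ℕ} {A : Matrix (Fin p) (Fin n) ℝ} {b : Fin p → ℝ}

lemma mulVec_add_smul (A : Matrix (Fin p) (Fin n) ℝ) (x w : Vec n) (t : ℝ) (i : Fin p) :
    (A *ᵥ (x + t • w).ofLp) i = (A *ᵥ x.ofLp) i + t * (A *ᵥ w.ofLp) i := by
  simp [Matrix.mulVec_add, Matrix.mulVec_smul]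

lemma mulVec_sub_apply (A : Matrix (Fin p) (Fin n) ℝ) (x w : Vec n) (i : Fin p) :
    (A *ᵥ (x - w).ofLp) i = (A *ᵥ x.ofLp) i - (A *ᵥ w.ofLp) i := by
  simp [Matrix.mulVec_sub]

lemma continuous_mulVec_apply (A : Matrix (Fin p) (Fin n) ℝ) (i : Fin p) :
    Continuous fun x : Vec n => (A *ᵥ x.ofLp) i := by
  have : Continuous fun x : Vec n => A *ᵥ x.ofLp :=
    Continuous.matrix_mulVec continuous_const (PiLp.continuous_ofLp 2 _)
  exact (continuous_apply i).comp this

lemma isClosed_polyhedron (A : Matrix (Fin p) (Fin n) ℝ) (b : Fin p → ℝ) :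
    IsClosed (polyhedron A b) := by
  have : polyhedron A b = ⋂ i, {x | (A *ᵥ x.ofLp) i ≤ b i} := by
    ext x; simp [polyhedron]
  rw [this]
  exact isClosed_iInter fun i => isClosed_le (continuous_mulVec_apply A i) continuous_const

lemma convex_polyhedron (A : Matrix (Fin p) (Fin n) ℝ) (b : Fin p → ℝ) :
    Convex ℝ (polyhedron A b) := by
  intro x hx y hy s t hs ht hst i
  have h : (A *ᵥ (s • x + t • y).ofLp) i = s * (A *ᵥ x.ofLp) i + t * (A *ᵥ y.ofLp) i := by
    simp [Matrix.mulVec_add, Matrix.mulVec_smul]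
  rw [h]
  have e : b i = s * b i + t * b i := by rw [← add_mul, hst, one_mul]
  rw [e]
  gcongr
  · exact hx i
  · exact hy i

lemma exists_add_smul_mem_polyhedron {x w : Vec n} (hx : x ∈ polyhedron A b)
    (hw : ∀ i, IsActive A b x i → (A *ᵥ w.ofLp) i ≤ 0) :
    ∃ t : ℝ, 0 < t ∧ x + t • w ∈ polyhedron A b := by
  have h : ∀ᶠ t : ℝ in 𝓝[>] 0, ∀ i, (A *ᵥ (x + t • w).ofLp) i ≤ b i := by
    rw [eventually_all]
    intro i
    by_cases hi : IsActive A b x i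
    · filter_upwards [self_mem_nhdsWithin] with t ht
      rw [mulVec_add_smul, hi]
      nlinarith [hw i hi, mem_Ioi.1 ht]
    · have hlt : (A *ᵥ x.ofLp) i < b i := lt_of_le_of_ne (hx i) hi
      have hc : Tendsto (fun t : ℝ => (A *ᵥ x.ofLp) i + t * (A *ᵥ w.ofLp) i) (𝓝[>] 0)
          (𝓝 ((A *ᵥ x.ofLp) i + 0 * (A *ᵥ w.ofLp) i)) :=
        ((continuous_const.add (continuous_id.mul continuous_const)).tendsto 0).mono_left
          nhdsWithin_le_nhds
      rw [zero_mul, add_zero] at hc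
      have := hc.eventually_lt_const hlt
      filter_upwards [this] with t ht
      rw [mulVec_add_smul]
      exact ht.le
  obtain ⟨t, ht, ht'⟩ := (h.and self_mem_nhdsWithin).exists
  exact ⟨t, ht', ht⟩

lemma IsProj.inner_nonpos {z x w : Vec n} (h : IsProj (polyhedron A b) z x)
    (hw : ∀ i, IsActive A b x i → (A *ᵥ w.ofLp) i ≤ 0) : inner ℝ (z - x) w ≤ 0 := by
  obtain ⟨t, ht, hm⟩ := exists_add_smul_mem_polyhedron h.1 hw
  have := h.2 _ hm
  rw [add_sub_cancel_left, inner_smul_right] at this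
  by_contra! hlt
  nlinarith

lemma IsProj.inner_eq_zero {z x w : Vec n} (h : IsProj (polyhedron A b) z x)
    (hw : ∀ i, IsActive A b x i → (A *ᵥ w.ofLp) i = 0) : inner ℝ (z - x) w = 0 := by
  refine le_antisymm (h.inner_nonpos fun i hi => (hw i hi).le) ?_
  have := h.inner_nonpos (w := -w) fun i hi => by
    simp [Matrix.mulVec_neg, hw i hi]
  rw [inner_neg_right] at this
  linarith

/-- Near `xs`, only the constraints that are active at `xs` can be active. -/
lemma eventually_slack (xs : Vec n) :
    ∀ᶠ x in 𝓝 xs, ∀ i, (A *ᵥ xs.ofLp) i < b i → (A *ᵥ x.ofLp) i < b i := by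
  rw [eventually_all]
  intro i
  by_cases hi : (A *ᵥ xs.ofLp) i < b i
  · filter_upwards [((continuous_mulVec_apply A i).tendsto xs).eventually_lt_const hi] with x hx _
      using hx
  · exact Eventually.of_forall fun x h => absurd h hi

lemma IsProj.coupling_eq_of_slack {xs z x : Vec n} (hxs : xs ∈ polyhedron A b)
    (h : IsProj (polyhedron A b) z x)
    (hsl : ∀ i, (A *ᵥ xs.ofLp) i < b i → (A *ᵥ x.ofLp) i < b i) :
    coupling xs z x = ‖x - xs‖ ^ 2 / 2 := by
  rw [coupling_eq, h.inner_eq_zero (w := xs - x), sub_zero]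
  intro i hi
  have : (A *ᵥ xs.ofLp) i = b i := by
    by_contra hne
    exact (hsl i (lt_of_le_of_ne (hxs i) hne)).ne hi
  rw [mulVec_sub_apply, this, hi, sub_self]

lemma HasStrictMultiplier.inner_neg {xs g y : Vec n} (hg : HasStrictMultiplier A b xs g)
    (hy : y ∈ polyhedron A b) {i : Fin p} (hi : IsActive A b xs i) (hi' : ¬ IsActive A b y i) :
    inner ℝ g (y - xs) < 0 := by
  obtain ⟨lam, hpos, hzero, hlam⟩ := hg
  have e : inner ℝ g (y - xs) = ∑ j, lam j * (A *ᵥ (y - xs).ofLp) j := by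
    have : inner ℝ g (y - xs) = (y - xs).ofLp ⬝ᵥ g.ofLp := by
      rw [EuclideanSpace.inner_eq_star_dotProduct]; simp
    rw [this, hlam, dotProduct_comm, Matrix.mulVec_transpose, ← Matrix.dotProduct_mulVec]
    rfl
  rw [e]
  have key : ∀ j, lam j * (A *ᵥ (y - xs).ofLp) j ≤ 0 := by
    intro j
    by_cases hj : IsActive A b xs j
    · rw [mulVec_sub_apply, hj]
      nlinarith [hpos j hj, hy j]
    · rw [hzero j hj, zero_mul]
  refine (Finset.sum_lt_sum (fun j _ => key j) ⟨i, Finset.mem_univ i, ?_⟩).trans_eq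
    Finset.sum_const_zero
  have hlt : (A *ᵥ y.ofLp) i < b i := lt_of_le_of_ne (hy i) hi'
  rw [mulVec_sub_apply, hi]
  nlinarith [hpos i hi]

/-- Identification of the active constraints by projections of dual variables that grow in the
direction of a strictly complementary multiplier. -/
theorem eventually_satisfiesPattern {xs g : Vec n} {z x : ℕ → Vec n} {c : ℕ → ℝ}
    (hg : HasStrictMultiplier A b xs g) (hproj : ∀ k, IsProj (polyhedron A b) (z k) (x k))
    (hx : Tendsto x atTop (𝓝 xs)) (hc : Tendsto c atTop atTop)
    (hz : (fun k => z k - c k • g) =o[atTop] c) :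
    ∀ᶠ k in atTop, SatisfiesPattern A b xs (x k) := by
  classical
  have hslack := hx.eventually (eventually_slack (A := A) (b := b) xs)
  have hxs : xs ∈ polyhedron A b :=
    (isClosed_polyhedron A b).mem_of_tendsto hx (Eventually.of_forall fun k => (hproj k).1)
  have hdir : ∀ w, inner ℝ g w < 0 → ∀ᶠ k in atTop, inner ℝ (z k - x k) w ≠ 0 := by
    intro w hw
    have h1 : (fun k => z k - x k - c k • g) =o[atTop] c := by
      have hxo : x =o[atTop] c := by
        refine (hx.isBigO_one ℝ).trans_isLittleO ?_
        exact (Asymptotics.isLittleO_const_left (c := (1 : ℝ))).2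
          (Or.inr (tendsto_norm_atTop_atTop.comp hc))
      refine (hz.sub hxo).congr_left fun k => by abel
    have h2 := h1.def (c := (-(inner ℝ g w)) / (2 * (‖w‖ + 1))) (by
      have := norm_nonneg w
      have : 0 < -(inner ℝ g w) := by linarith
      positivity)
    filter_upwards [h2, hc.eventually_gt_atTop 0] with k hk hck h0
    have e : inner ℝ (z k - x k - c k • g) w = - (c k * inner ℝ g w) := by
      rw [inner_sub_left, h0, inner_smul_left]; simp
    have h3 := (abs_real_inner_le_norm (z k - x k - c k • g) w)
    rw [e, abs_of_nonneg (by nlinarith), ] at h3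
    rw [Real.norm_of_nonneg hck.le] at hk
    have hw0 := norm_nonneg w
    have h4 : ‖z k - x k - c k • g‖ * ‖w‖ ≤ -(inner ℝ g w) / (2 * (‖w‖ + 1)) * c k * ‖w‖ := by
      gcongr
    have h5 : -(inner ℝ g w) / (2 * (‖w‖ + 1)) * c k * ‖w‖ ≤ -(inner ℝ g w) / 2 * c k := by
      rw [div_mul_eq_mul_div, div_mul_eq_mul_div, div_le_iff₀ (by positivity)]
      have : 0 < -(inner ℝ g w) * c k := mul_pos (by linarith) hck
      nlinarith
    nlinarith [mul_pos (neg_pos.2 hw) hck]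
  have hpat : ∀ J : Finset (Fin p), ∀ᶠ k in atTop,
      (∀ i, IsActive A b (x k) i ↔ i ∈ J) → ∀ i, IsActive A b xs i → i ∈ J := by
    intro J
    by_cases hJ : ∃ k, (∀ i, IsActive A b (x k) i ↔ i ∈ J) ∧ (∀ i ∈ J, IsActive A b xs i) ∧
        ∃ i, IsActive A b xs i ∧ i ∉ J
    · obtain ⟨k₀, hk₀, hsub, i, hi, hiJ⟩ := hJ
      have hneg := hg.inner_neg (hproj k₀).1 hi (fun h => hiJ ((hk₀ i).1 h))
      filter_upwards [hdir _ hneg] with k hk hkJ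
      refine absurd ((hproj k).inner_eq_zero fun j hj => ?_) hk
      have hjJ := (hkJ j).1 hj
      rw [mulVec_sub_apply, (hk₀ j).2 hjJ, hsub j hjJ, sub_self]
    · filter_upwards [hslack] with k hk hkJ i hi
      by_contra hiJ
      refine hJ ⟨k, hkJ, fun j hj => ?_, i, hi, hiJ⟩
      by_contra hne
      exact (hk j (lt_of_le_of_ne (hxs j) hne)).ne ((hkJ j).2 hj)
  filter_upwards [eventually_all.2 hpat, hslack] with k hk hsl
  refine ⟨fun i hi => ?_, hsl⟩
  have := hk (Finset.univ.filter fun i => IsActive A b (x k) i) (by simp) i hi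
  exact (Finset.mem_filter.1 this).2

end Polyhedron

section Descent

/-- A perturbed nonincreasing nonnegative sequence converges when the partial sums of the
perturbation do, and its decrements are summable. -/
theorem summable_and_tendsto_of_perturbed_descent {R a e : ℕ → ℝ} {l : ℝ} (hR : ∀ n, 0 ≤ R n)
    (ha : ∀ n, 0 ≤ a n) (h : ∀ᶠ n in atTop, R (n + 1) ≤ R n - a n + e n)
    (he : Tendsto (fun n => ∑ k ∈ Finset.range n, e k) atTop (𝓝 l)) :
    Summable a ∧ ∃ L, Tendsto R atTop (𝓝 L) := by
  obtain ⟨N, hN⟩ := eventually_atTop.1 h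
  set S : ℕ → ℝ := fun n => ∑ k ∈ Finset.range n, e k with hS
  set T : ℕ → ℝ := fun n => R (n + N) - S (n + N) with hT
  have hstep : ∀ n, T (n + 1) ≤ T n - a (n + N) := by
    intro n
    have h1 := hN (n + N) (by omega)
    have e1 : n + 1 + N = n + N + 1 := by omega
    simp only [hT, hS, e1, Finset.sum_range_succ]
    linarith
  have hanti : Antitone T := antitone_nat_of_succ_le fun n => by linarith [hstep n, ha (n + N)]
  obtain ⟨B, hB⟩ := he.bddAbove_range
  have hlow : ∀ n, -B ≤ T n := fun n => by
    have : S (n + N) ≤ B := hB ⟨n + N, rfl⟩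
    simp only [hT]
    linarith [hR (n + N)]
  have hsum : ∀ n, ∑ k ∈ Finset.range n, a (k + N) ≤ T 0 - T n := by
    intro n
    induction n with
    | zero => simp
    | succ n ih => rw [Finset.sum_range_succ]; linarith [hstep n]
  refine ⟨(summable_nat_add_iff N).1 (summable_of_sum_range_le (c := T 0 + B)
    (fun n => ha _) fun n => (hsum n).trans (by linarith [hlow n])), ?_⟩
  have hconv := tendsto_atTop_ciInf hanti ⟨-B, by rintro _ ⟨n, rfl⟩; exact hlow n⟩
  refine ⟨_, (tendsto_add_atTop_iff_nat N).1
    ((hconv.add ((tendsto_add_atTop_iff_nat N).2 he)).congr fun n => ?_)⟩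
  simp [hT, hS]

lemma frequently_lt_of_summable_mul {a w : ℕ → ℝ} (ha : ∀ n, 0 ≤ a n)
    (hsum : ¬ Summable a) (haw : Summable fun n => a n * w n) {ε : ℝ} (hε : 0 < ε) :
    ∃ᶠ n in atTop, w n < ε := by
  intro h
  refine hsum ?_
  obtain ⟨N, hN⟩ := eventually_atTop.1 h
  rw [← summable_nat_add_iff N]
  refine Summable.of_nonneg_of_le (fun n => ha _) (fun n => ?_)
    (((summable_nat_add_iff N).2 haw).mul_left ε⁻¹)
  have := not_lt.1 (hN (n + N) (by omega))
  rw [← div_eq_inv_mul, le_div_iff₀ hε]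
  exact mul_le_mul_of_nonneg_left this (ha _)

end Descent

section DualAveraging

variable {p n : ℕ} {A : Matrix (Fin p) (Fin n) ℝ} {b : Fin p → ℝ} {xs : Vec n}
  {z x g h : ℕ → Vec n} {a ρ : ℕ → ℝ} {c : ℝ}

/-- Convergence of dual averaging over a polyhedron along a sample path. -/
theorem dualAveraging_tendsto (hxs : xs ∈ polyhedron A b)
    (hproj : ∀ k, IsProj (polyhedron A b) (z k) (x k))
    (hz : ∀ k, z (k + 1) = z k - a k • g k) (ha : ∀ k, 0 ≤ a k) (hasum : ¬ Summable a)
    (hg : Summable fun k => a k ^ 2 * ‖g k‖ ^ 2)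
    (hnoise : ∃ l, Tendsto (fun N => ∑ k ∈ Finset.range N, a k * inner ℝ (g k - h k) (x k - xs))
      atTop (𝓝 l))
    (hc : 0 < c) (hρ : Summable fun k => a k * ρ k)
    (hgrow : ∀ᶠ k in atTop, c * ‖x k - xs‖ ^ 2 - ρ k ≤ inner ℝ (h k) (x k - xs)) :
    Tendsto x atTop (𝓝 xs) ∧ Summable fun k => a k * ‖x k - xs‖ ^ 2 := by
  obtain ⟨l, hl⟩ := hnoise
  set R : ℕ → ℝ := fun k => coupling xs (z k) (x k) with hR
  have hRge : ∀ k, ‖x k - xs‖ ^ 2 / 2 ≤ R k := fun k => (hproj k).coupling_ge hxs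
  have hdesc : ∀ᶠ k in atTop, R (k + 1) ≤ R k - c * (a k * ‖x k - xs‖ ^ 2) +
      (a k * ρ k + 1 / 2 * (a k ^ 2 * ‖g k‖ ^ 2) - a k * inner ℝ (g k - h k) (x k - xs)) := by
    filter_upwards [hgrow] with k hk
    have h1 := (hproj k).coupling_sub_le (u := xs) (hz k ▸ hproj (k + 1))
    rw [← hz k, inner_smul_left, norm_smul, mul_pow, Real.norm_eq_abs, sq_abs] at h1
    have h2 := mul_le_mul_of_nonneg_left hk (ha k)
    simp only [hR]
    rw [inner_sub_left]
    simp only [conj_trivial] at h1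
    nlinarith
  have hlim := ((hρ.hasSum.tendsto_sum_nat.add (hg.mul_left (1 / 2)).hasSum.tendsto_sum_nat).sub hl)
  simp only [← Finset.sum_add_distrib, ← Finset.sum_sub_distrib] at hlim
  obtain ⟨hsum, L, hL⟩ := summable_and_tendsto_of_perturbed_descent
    (fun k => (by positivity : (0 : ℝ) ≤ _).trans (hRge k))
    (fun k => mul_nonneg hc.le (mul_nonneg (ha k) (sq_nonneg _))) hdesc hlim
  have hsum' : Summable fun k => a k * ‖x k - xs‖ ^ 2 :=
    (summable_mul_left_iff hc.ne').1 hsum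
  refine ⟨?_, hsum'⟩
  obtain ⟨δ, hδ, hδ'⟩ := Metric.eventually_nhds_iff.1 (eventually_slack (A := A) (b := b) xs)
  have hL0 : L ≤ 0 := by
    refine le_of_forall_pos_le_add fun ε hε => ?_
    rw [zero_add]
    have hfreq := frequently_lt_of_summable_mul ha hasum hsum'
      (ε := min (δ ^ 2) ε) (by positivity)
    refine le_of_tendsto_of_frequently hL (hfreq.mono fun k hk => ?_)
    have hk1 : ‖x k - xs‖ < δ :=
      lt_of_pow_lt_pow_left₀ 2 hδ.le (hk.trans_le (min_le_left _ _))
    have hk2 := hk.trans_le (min_le_right _ _)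
    simp only [hR]
    rw [(hproj k).coupling_eq_of_slack hxs (hδ' (by rwa [dist_eq_norm]))]
    linarith [sq_nonneg ‖x k - xs‖]
  have hsq : Tendsto (fun k => ‖x k - xs‖ ^ 2) atTop (𝓝 0) := by
    refine squeeze_zero' (Eventually.of_forall fun k => sq_nonneg _)
      (Eventually.of_forall fun k => (?_ : _ ≤ 2 * (R k - L))) ?_
    · linarith [hRge k]
    · simpa using (hL.sub_const L).const_mul 2
  rw [tendsto_iff_norm_sub_tendsto_zero]
  have := hsq.sqrt
  simpa [Real.sqrt_sq] using this

/-- Finite identification by dual averaging along a sample path. -/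
theorem dualAveraging_eventually_pattern {h' : Vec n}
    (hproj : ∀ k, IsProj (polyhedron A b) (z k) (x k))
    (hz : ∀ k, z (k + 1) = z k - a k • g k) (ha : ∀ k, 0 ≤ a k) (hasum : ¬ Summable a)
    (hx : Tendsto x atTop (𝓝 xs)) (hh : Tendsto h atTop (𝓝 h'))
    (hnoise : ∃ l, Tendsto (fun N => ∑ k ∈ Finset.range N, a k • (g k - h k)) atTop (𝓝 l))
    (hmult : HasStrictMultiplier A b xs (-h')) :
    ∀ᶠ k in atTop, SatisfiesPattern A b xs (x k) := by
  obtain ⟨l, hl⟩ := hnoise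
  have hc : Tendsto (fun N => ∑ k ∈ Finset.range N, a k) atTop atTop :=
    (not_summable_iff_tendsto_nat_atTop_of_nonneg ha).1 hasum
  have hone : (fun _ : ℕ => (1 : ℝ)) =o[atTop] fun N => ∑ k ∈ Finset.range N, a k :=
    Asymptotics.isLittleO_const_left.2 (Or.inr (tendsto_norm_atTop_atTop.comp hc))
  have h1 : (fun k => a k • (h k - h')) =o[atTop] a := by
    have : (fun k => h k - h') =o[atTop] fun _ => (1 : ℝ) := by
      rw [Asymptotics.isLittleO_one_iff]
      simpa using hh.sub_const h'
    simpa using (Asymptotics.isBigO_refl a atTop).smul_isLittleO this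
  have h2 := h1.sum_range ha hc
  have h3 := (hl.isBigO_one ℝ).trans_isLittleO hone
  have h4 : (fun _ : ℕ => z 0) =o[atTop] fun N => ∑ k ∈ Finset.range N, a k :=
    (Asymptotics.isBigO_const_const (z 0) one_ne_zero atTop).trans_isLittleO hone
  have hzsum : ∀ N, z N = z 0 - ∑ k ∈ Finset.range N, a k • g k := by
    intro N
    induction N with
    | zero => simp
    | succ N ih => rw [hz, ih, Finset.sum_range_succ]; abel
  refine eventually_satisfiesPattern hmult hproj hx hc (((h4.sub h3).sub h2).congr_left fun N => ?_)
  rw [hzsum N, smul_neg, sub_neg_eq_add, Finset.sum_smul]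
  simp only [smul_sub, Finset.sum_sub_distrib]
  abel

end DualAveraging

section MartingaleSums

variable {Ω : Type*} {mΩ : MeasurableSpace Ω} {Pr : Measure Ω} [IsProbabilityMeasure Pr]

lemma condExp_ae_eq_zero_of_setIntegral_eq_zero {𝒢 : MeasurableSpace Ω} (h𝒢 : 𝒢 ≤ mΩ) {X : Ω → ℝ}
    (hX : Integrable X Pr) (h : ∀ s, MeasurableSet[𝒢] s → ∫ ω in s, X ω ∂Pr = 0) :
    Pr[X | 𝒢] =ᵐ[Pr] 0 := by
  refine (ae_eq_condExp_of_forall_setIntegral_eq h𝒢 hX (fun s _ _ => integrableOn_zero)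
    (fun s hs _ => ?_) aestronglyMeasurable_zero).symm
  simp [h s hs]

lemma integral_mul_eq_zero_of_setIntegral_eq_zero {𝒢 : MeasurableSpace Ω} (h𝒢 : 𝒢 ≤ mΩ)
    {S X : Ω → ℝ} (hS : StronglyMeasurable[𝒢] S) (hS2 : MemLp S 2 Pr) (hX : MemLp X 2 Pr)
    (h : ∀ s, MeasurableSet[𝒢] s → ∫ ω in s, X ω ∂Pr = 0) : ∫ ω, S ω * X ω ∂Pr = 0 := by
  have hXi := hX.integrable one_le_two
  have h1 := condExp_mul_of_stronglyMeasurable_left (m := 𝒢) hS (hS2.integrable_mul hX) hXi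
  have h2 := condExp_ae_eq_zero_of_setIntegral_eq_zero h𝒢 hXi h
  have h3 : ∫ ω, (S * X) ω ∂Pr = 0 := by
    rw [← integral_condExp h𝒢 (f := S * X)]
    refine integral_eq_zero_of_ae ?_
    filter_upwards [h1, h2] with ω hω hω'
    rw [hω, Pi.mul_apply, hω', Pi.zero_apply, mul_zero]
  exact h3

/-- A series of square integrable martingale increments with summable variances converges. -/
theorem ae_tendsto_sum_of_martingale_increments {ℱ : Filtration ℕ mΩ} {X : ℕ → Ω → ℝ}
    (hmeas : ∀ n, StronglyMeasurable[ℱ (n + 1)] (X n)) (hL2 : ∀ n, MemLp (X n) 2 Pr)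
    (hzero : ∀ n s, MeasurableSet[ℱ n] s → ∫ ω in s, X n ω ∂Pr = 0)
    (hsum : Summable fun n => ∫ ω, X n ω ^ 2 ∂Pr) :
    ∀ᵐ ω ∂Pr, ∃ l, Tendsto (fun n => ∑ k ∈ Finset.range n, X k ω) atTop (𝓝 l) := by
  set S : ℕ → Ω → ℝ := fun n ω => ∑ k ∈ Finset.range n, X k ω with hS
  have hsucc : ∀ n, S (n + 1) = fun ω => S n ω + X n ω := fun n => by
    ext ω; simp [hS, Finset.sum_range_succ]
  have hSm : ∀ n, StronglyMeasurable[ℱ n] (S n) := by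
    intro n
    refine Finset.stronglyMeasurable_fun_sum _ fun k hk => ?_
    exact (hmeas k).mono (ℱ.mono (Finset.mem_range.1 hk))
  have hS2 : ∀ n, MemLp (S n) 2 Pr := fun n => memLp_finsetSum _ fun k _ => hL2 k
  have hmart : Martingale S ℱ Pr := by
    refine martingale_of_setIntegral_eq_succ hSm (fun n => (hS2 n).integrable one_le_two) ?_
    intro n s hs
    rw [hsucc, integral_add ((hS2 n).integrable one_le_two).integrableOn
      ((hL2 n).integrable one_le_two).integrableOn, hzero n s hs, add_zero]
  have hvar : ∀ n, ∫ ω, S n ω ^ 2 ∂Pr = ∑ k ∈ Finset.range n, ∫ ω, X k ω ^ 2 ∂Pr := by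
    intro n
    induction n with
    | zero => simp [hS]
    | succ n ih =>
      have e : ∀ ω, S (n + 1) ω ^ 2 = S n ω ^ 2 + (2 * (S n ω * X n ω) + X n ω ^ 2) := fun ω => by
        rw [hsucc]; ring
      have hi : Integrable (fun ω => 2 * (S n ω * X n ω)) Pr :=
        ((hS2 n).integrable_mul (hL2 n)).const_mul 2
      simp_rw [e]
      rw [integral_add (f := fun ω => S n ω ^ 2) (g := fun ω => 2 * (S n ω * X n ω) + X n ω ^ 2)
        (hS2 n).integrable_sq (hi.add (hL2 n).integrable_sq),
        integral_add hi (hL2 n).integrable_sq, integral_const_mul,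
        integral_mul_eq_zero_of_setIntegral_eq_zero (ℱ.le n) (hSm n) (hS2 n) (hL2 n) (hzero n),
        Finset.sum_range_succ, ih]
      ring
  set V := ∑' n, ∫ ω, X n ω ^ 2 ∂Pr with hV
  have hbd : ∀ n, eLpNorm (S n) 1 Pr ≤ ((1 + V).toNNReal : ENNReal) := by
    intro n
    have hi := (hS2 n).integrable one_le_two
    rw [eLpNorm_one_eq_lintegral_enorm, ← ofReal_integral_norm_eq_lintegral_enorm hi]
    refine ENNReal.ofReal_le_ofReal ?_
    have h1 : ∫ ω, ‖S n ω‖ ∂Pr ≤ ∫ ω, (1 + S n ω ^ 2) ∂Pr := by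
      refine integral_mono hi.norm ((integrable_const 1).add (hS2 n).integrable_sq) fun ω => ?_
      simp only
      rw [← sq_abs (S n ω), Real.norm_eq_abs]
      nlinarith [sq_nonneg (|S n ω| - 1), abs_nonneg (S n ω)]
    rw [integral_add (integrable_const 1) (hS2 n).integrable_sq, hvar] at h1
    have h2 := hsum.sum_le_tsum (Finset.range n) fun k _ => integral_nonneg fun ω => sq_nonneg _
    simp only [integral_const, probReal_univ, smul_eq_mul, mul_one] at h1
    linarith
  exact hmart.submartingale.exists_ae_tendsto_of_bdd hbd

end MartingaleSums

section ConditionalLaw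

variable {Ω T E : Type*} {𝒢 mΩ : MeasurableSpace Ω} {Pr : Measure Ω} [IsProbabilityMeasure Pr]
  {mT : MeasurableSpace T} {mE : MeasurableSpace E} {κ : Kernel T E} [IsMarkovKernel κ]
  {W : Ω → T} {Y : Ω → E}

lemma map_restrict_prodMk_eq_compProd (h𝒢 : 𝒢 ≤ mΩ) (hW : Measurable[𝒢] W) (hY : Measurable Y)
    (hlaw : ∀ B : Set E, MeasurableSet B → Pr⟦Y ⁻¹' B | 𝒢⟧ =ᵐ[Pr] fun ω => (κ (W ω)).real B)
    {s : Set Ω} (hs : MeasurableSet[𝒢] s) :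
    (Pr.restrict s).map (fun ω => (W ω, Y ω)) = ((Pr.restrict s).map W) ⊗ₘ κ := by
  have hW' : Measurable W := hW.mono h𝒢 le_rfl
  have : IsFiniteMeasure ((Pr.restrict s).map (fun ω => (W ω, Y ω))) :=
    Measure.isFiniteMeasure_map _ _
  refine Measure.ext_prod fun {S B} hS hB => ?_
  have hκB : Measurable fun t => κ t B := κ.measurable_coe hB
  rw [Measure.compProd_apply_prod hS hB, setLIntegral_map hS hκB hW',
    Measure.map_apply (hW'.prodMk hY) (hS.prod hB), Measure.restrict_restrict (hW' hS),
    mk_preimage_prod]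
  have hWS : MeasurableSet[𝒢] (W ⁻¹' S ∩ s) := (hW hS).inter hs
  have hYB := hY hB
  have h1 : ∫ ω in W ⁻¹' S ∩ s, (κ (W ω)).real B ∂Pr = Pr.real (Y ⁻¹' B ∩ (W ⁻¹' S ∩ s)) := by
    rw [← setIntegral_congr_ae (h𝒢 _ hWS) ((hlaw B hB).mono fun ω hω _ => hω),
      setIntegral_condExp h𝒢 ((integrable_const 1).indicator hYB) hWS,
      integral_indicator_const _ hYB, smul_eq_mul, mul_one, measureReal_restrict_apply hYB]
  have h2 : ∫⁻ ω in W ⁻¹' S ∩ s, κ (W ω) B ∂Pr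
      = ENNReal.ofReal (∫ ω in W ⁻¹' S ∩ s, (κ (W ω)).real B ∂Pr) := by
    rw [integral_eq_lintegral_of_nonneg_ae (Eventually.of_forall fun _ => measureReal_nonneg)
      (hκB.comp hW').ennreal_toReal.aestronglyMeasurable]
    have e : ∀ ω, ENNReal.ofReal ((κ (W ω)).real B) = κ (W ω) B := fun ω =>
      ENNReal.ofReal_toReal (measure_ne_top _ _)
    simp_rw [e]
    rw [ENNReal.ofReal_toReal]
    refine ((lintegral_mono fun ω => prob_le_one).trans_lt ?_).ne
    simp
  rw [h2, h1, ofReal_measureReal,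
    Measure.restrict_apply ((hW' hS).inter hYB)]
  congr 1
  ext ω; simp only [mem_inter_iff]; tauto

lemma lintegral_comp_prodMk (h𝒢 : 𝒢 ≤ mΩ) (hW : Measurable[𝒢] W) (hY : Measurable Y)
    (hlaw : ∀ B : Set E, MeasurableSet B → Pr⟦Y ⁻¹' B | 𝒢⟧ =ᵐ[Pr] fun ω => (κ (W ω)).real B)
    {f : T × E → ENNReal} (hf : Measurable f) :
    ∫⁻ ω, f (W ω, Y ω) ∂Pr = ∫⁻ ω, ∫⁻ y, f (W ω, y) ∂κ (W ω) ∂Pr := by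
  have hW' : Measurable W := hW.mono h𝒢 le_rfl
  have h := map_restrict_prodMk_eq_compProd h𝒢 hW hY hlaw (s := univ) MeasurableSet.univ
  rw [Measure.restrict_univ] at h
  rw [← lintegral_map hf (hW'.prodMk hY), h, Measure.lintegral_compProd hf,
    lintegral_map hf.lintegral_kernel_prod_right' hW']

lemma setIntegral_comp_prodMk (h𝒢 : 𝒢 ≤ mΩ) (hW : Measurable[𝒢] W) (hY : Measurable Y)
    (hlaw : ∀ B : Set E, MeasurableSet B → Pr⟦Y ⁻¹' B | 𝒢⟧ =ᵐ[Pr] fun ω => (κ (W ω)).real B)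
    {f : T × E → ℝ} (hf : Measurable f) (hint : Integrable (fun ω => f (W ω, Y ω)) Pr)
    {s : Set Ω} (hs : MeasurableSet[𝒢] s) :
    ∫ ω in s, f (W ω, Y ω) ∂Pr = ∫ ω in s, ∫ y, f (W ω, y) ∂κ (W ω) ∂Pr := by
  have hW' : Measurable W := hW.mono h𝒢 le_rfl
  have h := map_restrict_prodMk_eq_compProd h𝒢 hW hY hlaw hs
  have hpair : Measurable fun ω => (W ω, Y ω) := hW'.prodMk hY
  have hi : Integrable f ((Pr.restrict s).map (fun ω => (W ω, Y ω))) :=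
    (integrable_map_measure hf.aestronglyMeasurable hpair.aemeasurable).2 hint.integrableOn
  rw [← integral_map hpair.aemeasurable hf.aestronglyMeasurable, h,
    Measure.integral_compProd (h ▸ hi), integral_map hW'.aemeasurable]
  exact (hf.stronglyMeasurable.integral_kernel_prod_right').aestronglyMeasurable

lemma lintegral_ofReal_comp_prodMk_le (h𝒢 : 𝒢 ≤ mΩ) (hW : Measurable[𝒢] W) (hY : Measurable Y)
    (hlaw : ∀ B : Set E, MeasurableSet B → Pr⟦Y ⁻¹' B | 𝒢⟧ =ᵐ[Pr] fun ω => (κ (W ω)).real B)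
    {f : T × E → ℝ} (hf : Measurable f) (hf0 : ∀ x, 0 ≤ f x) {T₀ : Set T} (hT : ∀ ω, W ω ∈ T₀)
    {K : ℝ} (hK : ∀ t ∈ T₀, Integrable (fun y => f (t, y)) (κ t) ∧ ∫ y, f (t, y) ∂κ t ≤ K) :
    ∫⁻ ω, ENNReal.ofReal (f (W ω, Y ω)) ∂Pr ≤ ENNReal.ofReal K := by
  rw [lintegral_comp_prodMk h𝒢 hW hY hlaw (f := fun x => ENNReal.ofReal (f x)) hf.ennreal_ofReal]
  refine (lintegral_mono fun ω => ?_).trans_eq (by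
    rw [lintegral_const, measure_univ, mul_one] : ∫⁻ _, ENNReal.ofReal K ∂Pr = _)
  obtain ⟨h1, h2⟩ := hK _ (hT ω)
  rw [← ofReal_integral_eq_lintegral_ofReal h1 (Eventually.of_forall fun y => hf0 _)]
  exact ENNReal.ofReal_le_ofReal h2

lemma integral_sq_comp_prodMk_le (h𝒢 : 𝒢 ≤ mΩ) (hW : Measurable[𝒢] W) (hY : Measurable Y)
    (hlaw : ∀ B : Set E, MeasurableSet B → Pr⟦Y ⁻¹' B | 𝒢⟧ =ᵐ[Pr] fun ω => (κ (W ω)).real B)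
    {f : T × E → ℝ} (hf : Measurable f) {T₀ : Set T} (hT : ∀ ω, W ω ∈ T₀)
    {K : ℝ} (hK0 : 0 ≤ K)
    (hK : ∀ t ∈ T₀, Integrable (fun y => f (t, y) ^ 2) (κ t) ∧ ∫ y, f (t, y) ^ 2 ∂κ t ≤ K) :
    MemLp (fun ω => f (W ω, Y ω)) 2 Pr ∧ ∫ ω, f (W ω, Y ω) ^ 2 ∂Pr ≤ K := by
  have hm : Measurable fun ω => f (W ω, Y ω) := hf.comp ((hW.mono h𝒢 le_rfl).prodMk hY)
  have h := lintegral_ofReal_comp_prodMk_le h𝒢 hW hY hlaw (f := fun x => f x ^ 2) (hf.pow_const 2)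
    (fun x => sq_nonneg _) hT hK
  have hi : Integrable (fun ω => f (W ω, Y ω) ^ 2) Pr := by
    refine ⟨(hm.pow_const 2).aestronglyMeasurable, ?_⟩
    rw [hasFiniteIntegral_iff_ofReal (Eventually.of_forall fun ω => sq_nonneg _)]
    exact h.trans_lt ENNReal.ofReal_lt_top
  refine ⟨(memLp_two_iff_integrable_sq hm.aestronglyMeasurable).2 hi, ?_⟩
  rwa [← ofReal_integral_eq_lintegral_ofReal hi (Eventually.of_forall fun ω => sq_nonneg _),
    ENNReal.ofReal_le_ofReal_iff hK0] at h

end ConditionalLaw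

lemma norm_integral_le_of_integral_sq_le {E V : Type*} [MeasurableSpace E] [NormedAddCommGroup V]
    [NormedSpace ℝ V] {ν : Measure E} [IsProbabilityMeasure ν] {φ : E → V} {K : ℝ}
    (hφ : Integrable φ ν) (h2 : Integrable (fun y => ‖φ y‖ ^ 2) ν)
    (hK : ∫ y, ‖φ y‖ ^ 2 ∂ν ≤ K) : ‖∫ y, φ y ∂ν‖ ≤ 1 + K := by
  refine (norm_integral_le_integral_norm φ).trans ?_
  have h : ∫ y, ‖φ y‖ ∂ν ≤ ∫ y, (1 + ‖φ y‖ ^ 2) ∂ν :=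
    integral_mono hφ.norm ((integrable_const 1).add h2) fun y => by
      nlinarith [sq_nonneg (‖φ y‖ - 1), norm_nonneg (φ y)]
  rw [integral_add (integrable_const 1) h2] at h
  simp only [integral_const, probReal_univ, smul_eq_mul, mul_one] at h
  linarith

lemma integrable_of_integrable_norm_sq {E V : Type*} [MeasurableSpace E] [NormedAddCommGroup V]
    {ν : Measure E} [IsFiniteMeasure ν] {φ : E → V} (hφ : AEStronglyMeasurable φ ν)
    (h2 : Integrable (fun y => ‖φ y‖ ^ 2) ν) : Integrable φ ν :=
  ((memLp_two_iff_integrable_sq_norm hφ).2 h2).integrable one_le_two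

section Noise

variable {Ω T E : Type*} {mΩ : MeasurableSpace Ω} {Pr : Measure Ω} [IsProbabilityMeasure Pr]
  {mT : MeasurableSpace T} {mE : MeasurableSpace E} {κ : Kernel T E} [IsMarkovKernel κ]
  {ℱ : Filtration ℕ mΩ} {W : ℕ → Ω → T} {Y : ℕ → Ω → E} {T₀ : Set T} {d : ℕ}
  {φ : T × E → Vec d} {K : ℝ} {a : ℕ → ℝ}

theorem ae_summable_sq_norm (hW : ∀ n, Measurable[ℱ n] (W n)) (hY : ∀ n, Measurable (Y n))
    (hlaw : ∀ n, ∀ B : Set E, MeasurableSet B →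
      Pr⟦Y n ⁻¹' B | ℱ n⟧ =ᵐ[Pr] fun ω => (κ (W n ω)).real B)
    (hT : ∀ n ω, W n ω ∈ T₀) (hφ : Measurable φ)
    (hK : ∀ t ∈ T₀, Integrable (fun y => ‖φ (t, y)‖ ^ 2) (κ t) ∧ ∫ y, ‖φ (t, y)‖ ^ 2 ∂κ t ≤ K)
    (ha : Summable fun n => a n ^ 2) :
    ∀ᵐ ω ∂Pr, Summable fun n => a n ^ 2 * ‖φ (W n ω, Y n ω)‖ ^ 2 := by
  have hm : ∀ n, Measurable fun ω => φ (W n ω, Y n ω) := fun n =>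
    hφ.comp (((hW n).mono (ℱ.le n) le_rfl).prodMk (hY n))
  have hm' : ∀ n, Measurable fun ω => ENNReal.ofReal (a n ^ 2 * ‖φ (W n ω, Y n ω)‖ ^ 2) := fun n =>
    (((hm n).norm.pow_const 2).const_mul _).ennreal_ofReal
  have hfin : ∫⁻ ω, ∑' n, ENNReal.ofReal (a n ^ 2 * ‖φ (W n ω, Y n ω)‖ ^ 2) ∂Pr ≠ ⊤ := by
    rw [lintegral_tsum fun n => (hm' n).aemeasurable]
    have hle : ∀ n, ∫⁻ ω, ENNReal.ofReal (a n ^ 2 * ‖φ (W n ω, Y n ω)‖ ^ 2) ∂Pr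
        ≤ ENNReal.ofReal (a n ^ 2) * ENNReal.ofReal K := by
      intro n
      simp_rw [ENNReal.ofReal_mul (sq_nonneg (a n))]
      rw [lintegral_const_mul _ ((hm n).norm.pow_const 2).ennreal_ofReal]
      gcongr
      exact lintegral_ofReal_comp_prodMk_le (ℱ.le n) (hW n) (hY n) (hlaw n)
        (f := fun x => ‖φ x‖ ^ 2) (hφ.norm.pow_const 2) (fun x => sq_nonneg _) (hT n) hK
    refine ((ENNReal.tsum_le_tsum hle).trans_lt ?_).ne
    rw [ENNReal.tsum_mul_right, ← ENNReal.ofReal_tsum_of_nonneg (fun n => sq_nonneg _) ha]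
    exact ENNReal.mul_lt_top ENNReal.ofReal_lt_top ENNReal.ofReal_lt_top
  filter_upwards [ae_lt_top (Measurable.tsum hm') hfin] with ω hω
  refine (ENNReal.summable_toReal hω.ne).congr fun n => ?_
  rw [ENNReal.toReal_ofReal (by positivity)]

theorem ae_tendsto_sum_inner_noise (hW : ∀ n, Measurable[ℱ n] (W n))
    (hY : ∀ n, Measurable[ℱ (n + 1)] (Y n))
    (hlaw : ∀ n, ∀ B : Set E, MeasurableSet B →
      Pr⟦Y n ⁻¹' B | ℱ n⟧ =ᵐ[Pr] fun ω => (κ (W n ω)).real B)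
    (hT : ∀ n ω, W n ω ∈ T₀) (hφ : Measurable φ)
    (hK : ∀ t ∈ T₀, Integrable (fun y => ‖φ (t, y)‖ ^ 2) (κ t) ∧ ∫ y, ‖φ (t, y)‖ ^ 2 ∂κ t ≤ K)
    (ha : Summable fun n => a n ^ 2) {u : T → Vec d} (hu : Measurable u) {B : ℝ}
    (hB : ∀ t ∈ T₀, ‖u t‖ ≤ B) :
    ∀ᵐ ω ∂Pr, ∃ l, Tendsto (fun N => ∑ k ∈ Finset.range N,
      a k * inner ℝ (φ (W k ω, Y k ω) - ∫ y, φ (W k ω, y) ∂κ (W k ω)) (u (W k ω)))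
        atTop (𝓝 l) := by
  set h : T → Vec d := fun t => ∫ y, φ (t, y) ∂κ t with hh
  have hhm : Measurable h := (hφ.stronglyMeasurable.integral_kernel_prod_right').measurable
  set ψ : T × E → ℝ := fun x => inner ℝ (φ x - h x.1) (u x.1) with hψ
  have hψm : Measurable ψ := (hφ.sub (hhm.comp measurable_fst)).inner (hu.comp measurable_fst)
  have hφi : ∀ t ∈ T₀, Integrable (fun y => φ (t, y)) (κ t) := fun t ht =>
    integrable_of_integrable_norm_sq (hφ.comp measurable_prodMk_left).aestronglyMeasurable (hK t ht).1
  set K' : ℝ := B ^ 2 * (2 * K + 2 * (1 + K) ^ 2) with hK'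
  have hsq : ∀ t ∈ T₀, Integrable (fun y => ψ (t, y) ^ 2) (κ t) ∧ ∫ y, ψ (t, y) ^ 2 ∂κ t ≤ K' := by
    intro t ht
    obtain ⟨h1, h2⟩ := hK t ht
    have hh0 : ‖h t‖ ≤ 1 + K := norm_integral_le_of_integral_sq_le (hφi t ht) h1 h2
    have hbd : ∀ y, ψ (t, y) ^ 2 ≤ B ^ 2 * (2 * ‖φ (t, y)‖ ^ 2 + 2 * (1 + K) ^ 2) := by
      intro y
      have e1 := abs_real_inner_le_norm (φ (t, y) - h t) (u t)
      have e2 : ‖φ (t, y) - h t‖ ≤ ‖φ (t, y)‖ + (1 + K) := (norm_sub_le _ _).trans (by linarith)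
      have e3 : |ψ (t, y)| ≤ (‖φ (t, y)‖ + (1 + K)) * B :=
        e1.trans (mul_le_mul e2 (hB t ht) (norm_nonneg _) ((norm_nonneg _).trans e2))
      rw [← sq_abs]
      calc |ψ (t, y)| ^ 2 ≤ ((‖φ (t, y)‖ + (1 + K)) * B) ^ 2 := by gcongr
        _ ≤ _ := by
          rw [mul_pow, mul_comm]
          gcongr
          nlinarith [sq_nonneg (‖φ (t, y)‖ - (1 + K))]
    have hbi : Integrable (fun y => B ^ 2 * (2 * ‖φ (t, y)‖ ^ 2 + 2 * (1 + K) ^ 2)) (κ t) :=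
      ((h1.const_mul 2).add (integrable_const _)).const_mul _
    have hi : Integrable (fun y => ψ (t, y) ^ 2) (κ t) := by
      refine hbi.mono' ((hψm.comp measurable_prodMk_left).pow_const 2).aestronglyMeasurable
        (Eventually.of_forall fun y => ?_)
      rw [Real.norm_of_nonneg (sq_nonneg _)]
      exact hbd y
    refine ⟨hi, (integral_mono hi hbi hbd).trans ?_⟩
    rw [integral_const_mul, integral_add (h1.const_mul 2) (integrable_const _), integral_const_mul,
      integral_const, probReal_univ, one_smul]
    simp only [hK']
    gcongr
  rcases isEmpty_or_nonempty Ω with hΩ | ⟨⟨ω₀⟩⟩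
  · exact Eventually.of_forall fun ω => (hΩ.false ω).elim
  have hK0 : 0 ≤ K' := (integral_nonneg fun y => sq_nonneg _).trans (hsq _ (hT 0 ω₀)).2
  have hYm : ∀ n, Measurable (Y n) := fun n => (hY n).mono (ℱ.le _) le_rfl
  have hL := fun n =>
    integral_sq_comp_prodMk_le (ℱ.le n) (hW n) (hYm n) (hlaw n) hψm (hT n) hK0 hsq
  refine ae_tendsto_sum_of_martingale_increments (ℱ := ℱ)
    (X := fun n ω => a n * ψ (W n ω, Y n ω)) (fun n => ?_) (fun n => (hL n).1.const_mul (a n))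
    (fun n s hs => ?_) ?_
  · exact ((hψm.comp (((hW n).mono (ℱ.mono n.le_succ) le_rfl).prodMk (hY n))).const_mul
      (a n)).stronglyMeasurable
  · rw [integral_const_mul, setIntegral_comp_prodMk (ℱ.le n) (hW n) (hYm n) (hlaw n) hψm
      ((hL n).1.integrable one_le_two) hs]
    have : ∀ ω, ∫ y, ψ (W n ω, y) ∂κ (W n ω) = 0 := by
      intro ω
      have hi := hφi _ (hT n ω)
      simp only [hψ]
      simp_rw [real_inner_comm (u (W n ω))]
      rw [integral_inner (f := fun y => φ (W n ω, y) - h (W n ω)) (hi.sub (integrable_const _)),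
        integral_sub hi (integrable_const _)]
      simp [hh]
    simp [this]
  · refine Summable.of_nonneg_of_le (fun n => integral_nonneg fun ω => sq_nonneg _) (fun n => ?_)
      (ha.mul_right K')
    simp_rw [mul_pow]
    rw [integral_const_mul]
    exact mul_le_mul_of_nonneg_left (hL n).2 (sq_nonneg _)

theorem ae_tendsto_sum_noise (hW : ∀ n, Measurable[ℱ n] (W n))
    (hY : ∀ n, Measurable[ℱ (n + 1)] (Y n))
    (hlaw : ∀ n, ∀ B : Set E, MeasurableSet B →
      Pr⟦Y n ⁻¹' B | ℱ n⟧ =ᵐ[Pr] fun ω => (κ (W n ω)).real B)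
    (hT : ∀ n ω, W n ω ∈ T₀) (hφ : Measurable φ)
    (hK : ∀ t ∈ T₀, Integrable (fun y => ‖φ (t, y)‖ ^ 2) (κ t) ∧ ∫ y, ‖φ (t, y)‖ ^ 2 ∂κ t ≤ K)
    (ha : Summable fun n => a n ^ 2) :
    ∀ᵐ ω ∂Pr, ∃ l, Tendsto (fun N => ∑ k ∈ Finset.range N,
      a k • (φ (W k ω, Y k ω) - ∫ y, φ (W k ω, y) ∂κ (W k ω))) atTop (𝓝 l) := by
  have h : ∀ i : Fin d, ∀ᵐ ω ∂Pr, ∃ l, Tendsto (fun N => ∑ k ∈ Finset.range N,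
      a k * inner ℝ (φ (W k ω, Y k ω) - ∫ y, φ (W k ω, y) ∂κ (W k ω))
        (EuclideanSpace.single i 1)) atTop (𝓝 l) := fun i =>
    ae_tendsto_sum_inner_noise hW hY hlaw hT hφ hK ha (u := fun _ => EuclideanSpace.single i 1)
      measurable_const (fun t _ => le_rfl)
  filter_upwards [ae_all_iff.2 h] with ω hω
  choose l hl using hω
  refine ⟨WithLp.toLp 2 l, ?_⟩
  have : Tendsto (fun N => (∑ k ∈ Finset.range N,
      a k • (φ (W k ω, Y k ω) - ∫ y, φ (W k ω, y) ∂κ (W k ω))).ofLp) atTop (𝓝 l) := by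
    rw [tendsto_pi_nhds]
    intro i
    refine (hl i).congr fun N => ?_
    simp [EuclideanSpace.inner_single_right]
  exact (PiLp.continuous_toLp 2 _).tendsto l |>.comp this

end Noise

section Convexity

variable {E : Type*} [NormedAddCommGroup E] [InnerProductSpace ℝ E] [CompleteSpace E]

lemma ConvexOn.sub_le_inner_of_hasGradientWithinAt {K : Set E} {f : E → ℝ} {g x y : E}
    (hf : ConvexOn ℝ K f) (hx : x ∈ K) (hy : y ∈ K) (hg : HasGradientWithinAt f g K x) :
    f x - f y ≤ inner ℝ g (x - y) := by
  have hline : HasDerivWithinAt (fun t : ℝ => x + t • (y - x)) (y - x) (Icc 0 1) 0 := by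
    simpa using ((hasDerivAt_id (0 : ℝ)).smul_const (y - x)).const_add x |>.hasDerivWithinAt
  have hmaps : MapsTo (fun t : ℝ => x + t • (y - x)) (Icc 0 1) K := fun t ht =>
    hf.1.add_smul_sub_mem hx hy ht
  have hd : HasDerivWithinAt (fun t : ℝ => f (x + t • (y - x))) (inner ℝ g (y - x)) (Icc 0 1) 0 := by
    have hg' : HasFDerivWithinAt f (InnerProductSpace.toDual ℝ E g) K (x + (0 : ℝ) • (y - x)) := by
      simpa using hg.hasFDerivWithinAt
    have := hg'.comp_hasDerivWithinAt (0 : ℝ) hline hmaps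
    rwa [InnerProductSpace.toDual_apply_apply] at this
  rw [hasDerivWithinAt_iff_tendsto_slope] at hd
  have hne : (𝓝[Icc (0 : ℝ) 1 \ {0}] 0).NeBot := by
    rw [Icc_sdiff_left, nhdsWithin_Ioc_eq_nhdsGT zero_lt_one]
    infer_instance
  have hle : inner ℝ g (y - x) ≤ f y - f x := by
    refine le_of_tendsto hd ?_
    filter_upwards [self_mem_nhdsWithin] with t ht
    have ht0 : 0 < t := lt_of_le_of_ne ht.1.1 (Ne.symm ht.2)
    have hc := hf.2 hx hy (sub_nonneg.2 ht.1.2) ht0.le (sub_add_cancel 1 t)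
    have e : (1 - t) • x + t • y = x + t • (y - x) := by
      rw [sub_smul, smul_sub, one_smul]; abel
    rw [e, smul_eq_mul, smul_eq_mul] at hc
    rw [slope_def_field, zero_smul, add_zero, sub_zero, div_le_iff₀ ht0]
    linarith
  have e : x - y = -(y - x) := by abel
  rw [e, inner_neg_right]
  linarith

end Convexity

lemma measurable_activeProj_apply {p n : ℕ} (A : Matrix (Fin p) (Fin n) ℝ) (b : Fin p → ℝ) :
    Measurable fun z : Vec n × Vec n => activeProj A b z.1 z.2 := by
  classical
  set J : Vec n → Set (Fin p) := fun x => {i | IsActive A b x i} with hJ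
  have hJm : Measurable J := by
    rw [measurable_set_iff]
    intro i
    exact measurableSet_setOfPred.1
      (measurableSet_eq_fun (continuous_mulVec_apply A i).measurable measurable_const)
  have hcongr : ∀ x y, J x = J y → activeProj A b x = activeProj A b y := by
    intro x y h
    have hs : activeNullSpace A b x = activeNullSpace A b y := by
      ext w
      change (∀ i, i ∈ J x → _) ↔ (∀ i, i ∈ J y → _)
      rw [h]
    simp only [activeProj, hs]
  set c : Set (Fin p) → (Vec n →L[ℝ] Vec n) := fun S =>
    if h : ∃ x, J x = S then activeProj A b h.choose else 0 with hc
  have hfac : activeProj A b = c ∘ J := by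
    ext1 x
    have h : ∃ y, J y = J x := ⟨x, rfl⟩
    simp only [hc, Function.comp_apply, dif_pos h]
    exact (hcongr _ _ h.choose_spec).symm
  have hm : Measurable (activeProj A b) := by
    rw [hfac]
    exact (measurable_of_countable c).comp hJm
  exact ContinuousLinearMap.measurable_apply₂.comp ((hm.comp measurable_fst).prodMk measurable_snd)

namespace Data

variable {s r m p q : ℕ} {D : Data s r m p q} {θs : Vec s} {μs : Vec m}

/-- The kernel `(θ, μ) ↦ Q μ`. -/
noncomputable def samplingKernel (D : Data s r m p q) : Kernel (Vec s × Vec m) (Vec r) :=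
  D.Q.comap Prod.snd measurable_snd

lemma samplingKernel_apply (t : Vec s × Vec m) : D.samplingKernel t = D.Q t.2 :=
  Kernel.comap_apply _ _ _

lemma IsModel.measurable_Gis (h : D.IsModel) :
    Measurable fun x : (Vec s × Vec m) × Vec r => D.Gis x.1.1 x.1.2 x.2 :=
  (h.measurable_ell.comp (measurable_snd.prodMk (measurable_snd.comp measurable_fst))).smul
    (h.measurable_G.comp ((measurable_fst.comp measurable_fst).prodMk measurable_snd))

lemma IsModel.measurable_activeProj_G (h : D.IsModel) :
    Measurable fun z : Vec s × Vec r => activeProj D.A D.b z.1 (D.G z.1 z.2) := by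
  have h1 : Measurable fun z : Vec s × Vec r => (z.1, D.G z.1 z.2) :=
    measurable_fst.prodMk h.measurable_G
  simpa only [Function.comp_def] using (measurable_activeProj_apply D.A D.b).comp h1

lemma IsModel.measurable_H (h : D.IsModel) :
    Measurable fun x : (Vec s × Vec m) × Vec r => D.H x.1.1 x.1.2 x.2 := by
  have h0 : Measurable fun x : (Vec s × Vec m) × Vec r => (x.1.1, x.2) :=
    (measurable_fst.comp measurable_fst).prodMk measurable_snd
  have h1 : Measurable fun x : (Vec s × Vec m) × Vec r =>
      activeProj D.A D.b x.1.1 (D.G x.1.1 x.2) := by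
    simpa only [Function.comp_def] using h.measurable_activeProj_G.comp h0
  have h2 : Measurable fun x : (Vec s × Vec m) × Vec r => D.gradEll x.2 x.1.2 :=
    h.measurable_gradEll.comp (measurable_snd.prodMk (measurable_snd.comp measurable_fst))
  unfold H
  exact (h1.norm.pow_const 2).smul h2

lemma norm_activeProj_le {p n : ℕ} (A : Matrix (Fin p) (Fin n) ℝ) (b : Fin p → ℝ) (x g : Vec n) :
    ‖activeProj A b x g‖ ≤ ‖g‖ :=
  (activeNullSpace A b x).norm_starProjection_apply_le g

section Moments

lemma IsModel.measurable_ell_left (h : D.IsModel) (μ : Vec m) : Measurable fun x => D.ell x μ :=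
  h.measurable_ell.comp measurable_prodMk_right

lemma IsModel.integral_P_eq (h : D.IsModel) {V : Type*} [NormedAddCommGroup V] [NormedSpace ℝ V]
    {μ : Vec m} (hμ : μ ∈ D.M) (g : Vec r → V) :
    ∫ x, g x ∂D.P = ∫ x, D.ell x μ • g x ∂D.Q μ := by
  rw [h.ell_density μ hμ, integral_withDensity_eq_integral_toReal_smul
    (h.measurable_ell_left μ).ennreal_ofReal (Eventually.of_forall fun x => ENNReal.ofReal_lt_top)]
  simp_rw [ENNReal.toReal_ofReal (h.ell_nonneg μ hμ _)]

lemma IsModel.integrable_P_iff (h : D.IsModel) {V : Type*} [NormedAddCommGroup V]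
    [NormedSpace ℝ V] {μ : Vec m} (hμ : μ ∈ D.M) (g : Vec r → V) :
    Integrable g D.P ↔ Integrable (fun x => D.ell x μ • g x) (D.Q μ) := by
  rw [h.ell_density μ hμ, integrable_withDensity_iff_integrable_smul'
    (h.measurable_ell_left μ).ennreal_ofReal (Eventually.of_forall fun x => ENNReal.ofReal_lt_top)]
  simp_rw [ENNReal.toReal_ofReal (h.ell_nonneg μ hμ _)]

lemma IsModel.integral_samplingKernel_Gis (h : D.IsModel) {t : Vec s × Vec m} (ht : t.2 ∈ D.M) :
    ∫ y, D.Gis t.1 t.2 y ∂D.samplingKernel t = D.gradf t.1 := by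
  rw [samplingKernel_apply, gradf, h.integral_P_eq ht]
  rfl

lemma AssumptionIS.exists_moment_Gis (hIS : D.AssumptionIS θs μs) (h : D.IsModel) :
    ∃ K, ∀ t ∈ D.Theta ×ˢ D.M, Integrable (fun y => ‖D.Gis t.1 t.2 y‖ ^ 2) (D.samplingKernel t) ∧
      ∫ y, ‖D.Gis t.1 t.2 y‖ ^ 2 ∂D.samplingKernel t ≤ K := by
  obtain ⟨GM, hGM⟩ := hIS.moment_G
  refine ⟨GM ^ 2, fun t ht => ?_⟩
  obtain ⟨h1, h2⟩ := hGM t.1 ht.1 t.2 ht.2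
  have e : ∀ y, D.ell y t.2 • (‖D.G t.1 y‖ ^ 2 * D.ell y t.2) = ‖D.Gis t.1 t.2 y‖ ^ 2 := fun y => by
    rw [Gis, norm_smul, mul_pow, Real.norm_eq_abs, sq_abs, smul_eq_mul]; ring
  rw [h.integrable_P_iff ht.2] at h1
  rw [h.integral_P_eq ht.2] at h2
  simp_rw [e] at h1 h2
  rw [samplingKernel_apply]
  exact ⟨h1, h2⟩

lemma norm_H_sq (θ : Vec s) (μ : Vec m) (x : Vec r) :
    ‖D.H θ μ x‖ ^ 2 = ‖activeProj D.A D.b θ (D.G θ x)‖ ^ 4 * ‖D.gradEll x μ‖ ^ 2 := by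
  rw [H, norm_smul, mul_pow, Real.norm_of_nonneg (sq_nonneg _)]
  ring

lemma AssumptionIS.exists_moment_H (hIS : D.AssumptionIS θs μs) :
    ∃ K, ∀ t ∈ D.Theta ×ˢ D.M, Integrable (fun y => ‖D.H t.1 t.2 y‖ ^ 2) D.P ∧
      ∫ y, ‖D.H t.1 t.2 y‖ ^ 2 ∂D.P ≤ K := by
  obtain ⟨HM, hHM⟩ := hIS.moment_H
  refine ⟨HM ^ 2, fun t ht => ?_⟩
  simp_rw [norm_H_sq]
  exact hHM t.1 ht.1 t.2 ht.2

lemma AssumptionISClass.convexOn_ell (hC : D.AssumptionISClass) (h : D.IsModel) (x : Vec r) :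
    ConvexOn ℝ D.M (D.ell x) := by
  refine convexOn_iff_forall_pos.2 ⟨convex_polyhedron _ _, fun μ₁ h₁ μ₂ h₂ a b ha hb hab => ?_⟩
  exact (hC.log_convex x μ₁ h₁ μ₂ h₂ a b ha hb hab).trans
    (Real.geom_mean_le_arith_mean2_weighted ha.le hb.le (h.ell_nonneg _ h₁ x)
      (h.ell_nonneg _ h₂ x) hab)

lemma AssumptionIS.integrable_V (hIS : D.AssumptionIS θs μs) (h : D.IsModel) {θ : Vec s}
    (hθ : θ ∈ D.Theta) {μ : Vec m} (hμ : μ ∈ D.M) : Integrable (D.V θ μ) D.P := by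
  obtain ⟨GM, hGM⟩ := hIS.moment_G
  have hm : Measurable (D.V θ μ) :=
    ((h.measurable_activeProj_G.fun_comp measurable_prodMk_left).norm.pow_const 2).mul
      (h.measurable_ell_left μ)
  refine (hGM θ hθ μ hμ).1.mono' hm.aestronglyMeasurable (Eventually.of_forall fun x => ?_)
  have hl := h.ell_nonneg μ hμ x
  rw [V, Real.norm_of_nonneg (by positivity)]
  gcongr
  exact norm_activeProj_le _ _ _ _

lemma AssumptionIS.integrable_H (hIS : D.AssumptionIS θs μs) (h : D.IsModel) {θ : Vec s}
    (hθ : θ ∈ D.Theta) {μ : Vec m} (hμ : μ ∈ D.M) : Integrable (D.H θ μ) D.P := by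
  have := h.probP
  obtain ⟨K, hK⟩ := hIS.exists_moment_H
  have hp : Measurable fun x : Vec r => ((θ, μ), x) := measurable_prodMk_left
  have hm : Measurable fun x => D.H θ μ x := by
    simpa only [Function.comp_def] using h.measurable_H.comp hp
  obtain ⟨h1, -⟩ := hK (θ, μ) ⟨hθ, hμ⟩
  exact integrable_of_integrable_norm_sq hm.aestronglyMeasurable h1

/-- The gradient inequality for the convex function `v(θ, ·)`. -/
lemma AssumptionIS.v_sub_le_inner (hIS : D.AssumptionIS θs μs) (hC : D.AssumptionISClass)
    (h : D.IsModel) {θ : Vec s} (hθ : θ ∈ D.Theta) {μ μ' : Vec m} (hμ : μ ∈ D.M) (hμ' : μ' ∈ D.M) :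
    D.v θ μ - D.v θ μ' ≤ inner ℝ (D.gradv θ μ) (μ - μ') := by
  have hV := hIS.integrable_V h hθ hμ
  have hV' := hIS.integrable_V h hθ hμ'
  have hH := hIS.integrable_H h hθ hμ
  rw [v, v, ← integral_sub hV hV', gradv, real_inner_comm, ← integral_inner hH]
  refine integral_mono (hV.sub hV') (hH.const_inner _) fun x => ?_
  have h1 := ConvexOn.sub_le_inner_of_hasGradientWithinAt (hC.convexOn_ell h x) hμ hμ'
    (hC.differentiable x μ hμ)
  simp only [V, H, inner_smul_right]
  rw [← mul_sub, real_inner_comm]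
  exact mul_le_mul_of_nonneg_left h1 (sq_nonneg _)

end Moments

section Iteration

variable {Ω : Type*} {mΩ : MeasurableSpace Ω} {Pr : Measure Ω} {ℱ : Filtration ℕ mΩ}
  {step : ℕ → ℝ} {θ₀ : Vec s} {μ₀ : Vec m} {Y Z : ℕ → Ω → Vec r}
  {θ : ℕ → Ω → Vec s} {μ : ℕ → Ω → Vec m}

lemma isProj_of_forall_inner_add_le {E : Type*} [NormedAddCommGroup E] [InnerProductSpace ℝ E]
    {K : Set E} (hK : Convex ℝ K) {S x₀ x : E} (hx : x ∈ K)
    (h : ∀ w ∈ K, inner ℝ S x + 1 / 2 * ‖x - x₀‖ ^ 2 ≤ inner ℝ S w + 1 / 2 * ‖w - x₀‖ ^ 2) :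
    IsProj K (x₀ - S) x := by
  refine IsProj.of_forall_norm_le hK hx fun w hw => ?_
  have e : ∀ y, ‖y - (x₀ - S)‖ ^ 2 =
      ‖y - x₀‖ ^ 2 + 2 * (inner ℝ S y - inner ℝ S x₀) + ‖S‖ ^ 2 := fun y => by
    have : y - (x₀ - S) = (y - x₀) + S := by abel
    rw [this, norm_add_sq_real, real_inner_comm, inner_sub_right]
  rw [e, e]
  linarith [h w hw]

lemma IsIteration.isProj_theta (hI : D.IsIteration Pr ℱ step θ₀ μ₀ Y Z θ μ) (n : ℕ) (ω : Ω) :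
    IsProj D.Theta (θ₀ - ∑ k ∈ Finset.range (n + 1),
      step k • D.Gis (θ k ω) (μ k ω) (Y k ω)) (θ (n + 1) ω) := by
  have hm := hI.mem_step n ω
  refine isProj_of_forall_inner_add_le (convex_polyhedron _ _) hm.1 fun w hw => ?_
  have := isMinOn_iff.1 (hI.argmin_step n ω) (w, μ (n + 1) ω) ⟨hw, hm.2⟩
  simp only at this
  linarith

lemma IsIteration.isProj_mu (hI : D.IsIteration Pr ℱ step θ₀ μ₀ Y Z θ μ) (n : ℕ) (ω : Ω) :
    IsProj D.M (μ₀ - ∑ k ∈ Finset.range (n + 1),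
      step k • D.H (θ k ω) (μ k ω) (Z k ω)) (μ (n + 1) ω) := by
  have hm := hI.mem_step n ω
  refine isProj_of_forall_inner_add_le (convex_polyhedron _ _) hm.2 fun w hw => ?_
  have := isMinOn_iff.1 (hI.argmin_step n ω) (θ (n + 1) ω, w) ⟨hm.1, hw⟩
  simp only at this
  linarith

lemma IsIteration.measurable_iterates (hI : D.IsIteration Pr ℱ step θ₀ μ₀ Y Z θ μ)
    (h : D.IsModel) (hΘ : D.Theta.Nonempty) (hM : D.M.Nonempty) (n : ℕ) :
    Measurable[ℱ n] (θ n) ∧ Measurable[ℱ n] (μ n) := by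
  obtain ⟨π, hπ, hπ'⟩ := exists_continuous_proj (convex_polyhedron D.A D.b)
    (isClosed_polyhedron D.A D.b) hΘ
  obtain ⟨τ, hτ, hτ'⟩ := exists_continuous_proj (convex_polyhedron D.C D.d)
    (isClosed_polyhedron D.C D.d) hM
  induction n using Nat.strong_induction_on with
  | _ n ih =>
    cases n with
    | zero =>
      have e1 : θ 0 = fun _ => θ₀ := funext fun ω => (hI.init ω).1
      have e2 : μ 0 = fun _ => μ₀ := funext fun ω => (hI.init ω).2
      rw [e1, e2]
      exact ⟨measurable_const, measurable_const⟩
    | succ n =>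
      have hpair : ∀ k ∈ Finset.range (n + 1), Measurable[ℱ (n + 1)] fun ω => (θ k ω, μ k ω) := by
        intro k hk
        obtain ⟨h1, h2⟩ := ih k (Finset.mem_range.1 hk)
        have hle : ℱ k ≤ ℱ (n + 1) := ℱ.mono (Finset.mem_range.1 hk).le
        exact (h1.mono hle le_rfl).prodMk (h2.mono hle le_rfl)
      have hY : ∀ k ∈ Finset.range (n + 1), Measurable[ℱ (n + 1)] (Y k) := fun k hk =>
        (hI.measurable_Y k).mono (ℱ.mono (Finset.mem_range.1 hk)) le_rfl
      have hZ : ∀ k ∈ Finset.range (n + 1), Measurable[ℱ (n + 1)] (Z k) := fun k hk =>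
        (hI.measurable_Z k).mono (ℱ.mono (Finset.mem_range.1 hk)) le_rfl
      have hS1 : Measurable[ℱ (n + 1)] fun ω => θ₀ - ∑ k ∈ Finset.range (n + 1),
          step k • D.Gis (θ k ω) (μ k ω) (Y k ω) :=
        (Finset.measurable_fun_sum _ fun k hk =>
          (h.measurable_Gis.fun_comp ((hpair k hk).prodMk (hY k hk))).const_smul (step k)).const_sub θ₀
      have hS2 : Measurable[ℱ (n + 1)] fun ω => μ₀ - ∑ k ∈ Finset.range (n + 1),
          step k • D.H (θ k ω) (μ k ω) (Z k ω) :=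
        (Finset.measurable_fun_sum _ fun k hk =>
          (h.measurable_H.fun_comp ((hpair k hk).prodMk (hZ k hk))).const_smul (step k)).const_sub μ₀
      have e1 : θ (n + 1) = fun ω => π (θ₀ - ∑ k ∈ Finset.range (n + 1),
          step k • D.Gis (θ k ω) (μ k ω) (Y k ω)) :=
        funext fun ω => (hI.isProj_theta n ω).unique (hπ' _)
      have e2 : μ (n + 1) = fun ω => τ (μ₀ - ∑ k ∈ Finset.range (n + 1),
          step k • D.H (θ k ω) (μ k ω) (Z k ω)) :=
        funext fun ω => (hI.isProj_mu n ω).unique (hτ' _)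
      rw [e1, e2]
      exact ⟨hπ.measurable.comp hS1, hτ.measurable.comp hS2⟩

end Iteration

section PathwiseAnalysis

lemma AssumptionRegularity.exists_growth_theta (hReg : D.AssumptionRegularity θs μs)
    (hSO : D.AssumptionSO θs) : ∃ c : ℝ, 0 < c ∧ ∀ θ ∈ D.Theta,
      c * ‖θ - θs‖ ^ 2 ≤ inner ℝ (D.gradf θ) (θ - θs) := by
  obtain ⟨c, hc, h, -⟩ := hReg.growth
  exact ⟨c, hc, fun θ hθ => (h θ hθ).trans (ConvexOn.sub_le_inner_of_hasGradientWithinAt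
    hSO.convex hθ hSO.unique_minimizer.1 (hSO.gradient θ hθ))⟩

/-- Along a path on which the noise of both problems converges, both iterates identify the
active constraints. -/
theorem eventually_satisfiesPattern_of_noise (hModel : D.IsModel) (hSO : D.AssumptionSO θs)
    (hClass : D.AssumptionISClass) (hIS : D.AssumptionIS θs μs)
    (hReg : D.AssumptionRegularity θs μs) (hSC : D.AssumptionStrictCompl θs μs)
    {a : ℕ → ℝ} (ha : ∀ k, 0 ≤ a k) (hasum : ¬ Summable a)
    {x zx g : ℕ → Vec s} {y zy e : ℕ → Vec m}
    (hx : ∀ k, IsProj D.Theta (zx k) (x k)) (hzx : ∀ k, zx (k + 1) = zx k - a k • g k)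
    (hy : ∀ k, IsProj D.M (zy k) (y k)) (hzy : ∀ k, zy (k + 1) = zy k - a k • e k)
    (hg : Summable fun k => a k ^ 2 * ‖g k‖ ^ 2)
    (hg1 : ∃ l, Tendsto (fun N => ∑ k ∈ Finset.range N,
      a k * inner ℝ (g k - D.gradf (x k)) (x k - θs)) atTop (𝓝 l))
    (hg2 : ∃ l, Tendsto (fun N => ∑ k ∈ Finset.range N, a k • (g k - D.gradf (x k)))
      atTop (𝓝 l))
    (he : Summable fun k => a k ^ 2 * ‖e k‖ ^ 2)
    (he1 : ∃ l, Tendsto (fun N => ∑ k ∈ Finset.range N,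
      a k * inner ℝ (e k - D.gradv (x k) (y k)) (y k - μs)) atTop (𝓝 l))
    (he2 : ∃ l, Tendsto (fun N => ∑ k ∈ Finset.range N, a k • (e k - D.gradv (x k) (y k)))
      atTop (𝓝 l)) :
    ∀ᶠ k in atTop, SatisfiesPattern D.A D.b θs (x k) ∧ SatisfiesPattern D.C D.d μs (y k) := by
  have hθs : θs ∈ D.Theta := hSO.unique_minimizer.1
  have hμs : μs ∈ D.M := hIS.unique_minimizer.1
  obtain ⟨c, hc, hgrow⟩ := hReg.exists_growth_theta hSO
  obtain ⟨hxlim, hxsum⟩ := dualAveraging_tendsto (ρ := fun _ => 0) hθs hx hzx ha hasum hg hg1 hc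
    (by simp) (Eventually.of_forall fun k => by
      simpa using hgrow (x k) (hx k).1)
  have hgradf : Tendsto (fun k => D.gradf (x k)) atTop (𝓝 (D.gradf θs)) :=
    (hSO.gradient_continuous θs hθs).tendsto.comp
      (tendsto_nhdsWithin_iff.2 ⟨hxlim, Eventually.of_forall fun k => (hx k).1⟩)
  have hpx := dualAveraging_eventually_pattern hx hzx ha hasum hxlim hgradf hg2 hSC.multiplier_θ
  refine hpx.and ?_
  obtain ⟨c₃, hc₃⟩ := hReg.coupling
  have hcoup : ∀ᶠ k in atTop,
      ‖D.gradv (x k) (y k) - D.gradv θs (y k)‖ ≤ |c₃| * ‖x k - θs‖ ^ 2 := by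
    filter_upwards [hpx] with k hk
    exact (hc₃ _ (hy k).1 _ (hx k).1 hk).trans
      (mul_le_mul_of_nonneg_right (le_abs_self c₃) (sq_nonneg _))
  obtain ⟨c', hc', -, hgv⟩ := hReg.growth
  obtain ⟨B, hB⟩ := hIS.bounded.exists_norm_le
  have hdist : ∀ k, ‖y k - μs‖ ≤ 2 * B := fun k =>
    (norm_sub_le _ _).trans (by linarith [hB _ (hy k).1, hB _ hμs])
  have hgrowy : ∀ᶠ k in atTop, c' * ‖y k - μs‖ ^ 2 - |c₃| * ‖x k - θs‖ ^ 2 * (2 * B) ≤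
      inner ℝ (D.gradv (x k) (y k)) (y k - μs) := by
    filter_upwards [hcoup] with k hk
    have h1 := (hgv _ (hy k).1).trans (hIS.v_sub_le_inner hClass hModel hθs (hy k).1 hμs)
    have h2 := abs_real_inner_le_norm (D.gradv (x k) (y k) - D.gradv θs (y k)) (y k - μs)
    have h3 := h2.trans (mul_le_mul hk (hdist k) (norm_nonneg _) (by positivity))
    have h4 := neg_abs_le (inner ℝ (D.gradv (x k) (y k) - D.gradv θs (y k)) (y k - μs))
    rw [inner_sub_left] at h4 h3
    linarith
  obtain ⟨hylim, -⟩ := dualAveraging_tendsto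
    (ρ := fun k => |c₃| * ‖x k - θs‖ ^ 2 * (2 * B)) hμs hy hzy ha hasum he he1 hc'
    ((hxsum.mul_right (|c₃| * (2 * B))).congr fun k => by ring) hgrowy
  obtain ⟨c₂, -, hc₂⟩ := hReg.lipschitz
  have hgradv : Tendsto (fun k => D.gradv (x k) (y k)) atTop (𝓝 (D.gradv θs μs)) := by
    rw [tendsto_iff_norm_sub_tendsto_zero]
    have hlim : Tendsto (fun k => |c₃| * ‖x k - θs‖ ^ 2 + c₂ * ‖y k - μs‖) atTop
        (𝓝 (|c₃| * 0 ^ 2 + c₂ * 0)) :=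
      (((tendsto_iff_norm_sub_tendsto_zero.1 hxlim).pow 2).const_mul _).add
        ((tendsto_iff_norm_sub_tendsto_zero.1 hylim).const_mul _)
    refine squeeze_zero' (Eventually.of_forall fun k => norm_nonneg _) ?_ (by simpa using hlim)
    filter_upwards [hcoup] with k hk
    have := norm_add_le (D.gradv (x k) (y k) - D.gradv θs (y k)) (D.gradv θs (y k) - D.gradv θs μs)
    rw [sub_add_sub_cancel] at this
    linarith [hc₂ _ (hy k).1]
  exact dualAveraging_eventually_pattern hy hzy ha hasum hylim hgradv he2 hSC.multiplier_μ

end PathwiseAnalysis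

end Data

section Steps

lemma summable_step_sq {α γ : ℝ} (hγ : 1 / 2 < γ) :
    Summable fun n : ℕ => (α / (((n + 1 : ℕ) : ℝ) + 1) ^ γ) ^ 2 := by
  have h : Summable fun n : ℕ => α ^ 2 * (((n : ℝ) ^ (2 * γ))⁻¹) :=
    (Real.summable_nat_rpow_inv.2 (by linarith)).mul_left _
  refine ((summable_nat_add_iff 2).2 h).congr fun n => ?_
  have hn : (0 : ℝ) ≤ ((n + 2 : ℕ) : ℝ) := Nat.cast_nonneg _
  have e : ((n + 1 : ℕ) : ℝ) + 1 = ((n + 2 : ℕ) : ℝ) := by push_cast; ring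
  rw [e, mul_comm 2 γ, Real.rpow_mul hn, div_pow, div_eq_mul_inv]
  norm_cast

lemma not_summable_step {α γ : ℝ} (hα : 0 < α) (hγ : γ < 1) :
    ¬ Summable fun n : ℕ => α / (((n + 1 : ℕ) : ℝ) + 1) ^ γ := by
  intro h
  have h2 : Summable fun n : ℕ => α * (((n : ℝ) ^ γ)⁻¹) := by
    rw [← summable_nat_add_iff 2]
    refine h.congr fun n => ?_
    have e : ((n + 1 : ℕ) : ℝ) + 1 = ((n + 2 : ℕ) : ℝ) := by push_cast; ring
    rw [e, div_eq_mul_inv]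
  have := Real.summable_nat_rpow_inv.1 ((summable_mul_left_iff hα.ne').1 h2)
  linarith

end Steps

lemma exists_measurable_forall_ge_of_ae_eventually {Ω : Type*} [MeasurableSpace Ω]
    {Pr : Measure Ω} {S : ℕ → Set Ω} (hS : ∀ n, MeasurableSet (S n))
    (h : ∀ᵐ ω ∂Pr, ∀ᶠ n in atTop, ω ∈ S n) :
    ∃ N : Ω → ℕ, Measurable N ∧ ∀ᵐ ω ∂Pr, ∀ n ≥ N ω, ω ∈ S n := by
  classical
  have hT : ∀ N, MeasurableSet {ω | ∀ n ≥ N, ω ∈ S n} := fun N => by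
    simp only [ofPred_forall]
    exact MeasurableSet.iInter fun n => MeasurableSet.iInter fun _ => hS n
  have hex : ∀ ω, ∃ N, (∀ n ≥ N, ω ∈ S n) ∨ ¬ ∃ N, ∀ n ≥ N, ω ∈ S n := fun ω => by
    by_cases hω : ∃ N, ∀ n ≥ N, ω ∈ S n
    · obtain ⟨N, hN⟩ := hω
      exact ⟨N, Or.inl hN⟩
    · exact ⟨0, Or.inr hω⟩
  refine ⟨fun ω => Nat.find (hex ω), measurable_find hex fun k => (hT k).union ?_, ?_⟩
  · refine MeasurableSet.compl (s := {ω | ∃ N, ∀ n ≥ N, ω ∈ S n}) ?_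
    simp only [ofPred_exists]
    exact MeasurableSet.iUnion hT
  · filter_upwards [h] with ω hω
    exact (Nat.find_spec (hex ω)).resolve_right (not_not.2 (eventually_atTop.1 hω))

lemma measurableSet_satisfiesPattern {p n : ℕ} (A : Matrix (Fin p) (Fin n) ℝ) (b : Fin p → ℝ)
    (xs : Vec n) : MeasurableSet {x | SatisfiesPattern A b xs x} := by
  have hm : ∀ i, Measurable fun x : Vec n => (A *ᵥ x.ofLp) i := fun i =>
    (continuous_mulVec_apply A i).measurable
  refine MeasurableSet.inter (s₁ := {x | ∀ i, _ → _}) (s₂ := {x | ∀ i, _ → _}) ?_ ?_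
  · simp only [ofPred_forall]
    exact MeasurableSet.iInter fun i => MeasurableSet.iInter fun _ =>
      measurableSet_eq_fun (hm i) measurable_const
  · simp only [ofPred_forall]
    exact MeasurableSet.iInter fun i => MeasurableSet.iInter fun _ =>
      measurableSet_lt (hm i) measurable_const

namespace Data

theorem IsIteration.ae_eventually_satisfiesPattern {s r m p q : ℕ} {D : Data s r m p q}
    {θs : Vec s} {μs : Vec m} (hModel : D.IsModel) (hSO : D.AssumptionSO θs)
    (hClass : D.AssumptionISClass) (hIS : D.AssumptionIS θs μs)
    (hReg : D.AssumptionRegularity θs μs) (hSC : D.AssumptionStrictCompl θs μs)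
    {Ω : Type*} {mΩ : MeasurableSpace Ω} {Pr : Measure Ω} [IsProbabilityMeasure Pr]
    {ℱ : Filtration ℕ mΩ} {step : ℕ → ℝ} (hstep : ∀ k, 0 ≤ step k)
    (hsum : ¬ Summable fun k => step (k + 1)) (hsq : Summable fun k => step (k + 1) ^ 2)
    {θ₀ : Vec s} {μ₀ : Vec m} {Y Z : ℕ → Ω → Vec r} {θ : ℕ → Ω → Vec s} {μ : ℕ → Ω → Vec m}
    (hI : D.IsIteration Pr ℱ step θ₀ μ₀ Y Z θ μ) :
    ∀ᵐ ω ∂Pr, ∀ᶠ k in atTop, SatisfiesPattern D.A D.b θs (θ (k + 1) ω) ∧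
      SatisfiesPattern D.C D.d μs (μ (k + 1) ω) := by
  have := hModel.probP
  have := hModel.markovQ
  have hθs : θs ∈ D.Theta := hSO.unique_minimizer.1
  have hμs : μs ∈ D.M := hIS.unique_minimizer.1
  have : IsMarkovKernel D.samplingKernel := by unfold samplingKernel; infer_instance
  let ℱ' : Filtration ℕ mΩ :=
    ⟨fun n => ℱ (n + 1), fun i j hij => ℱ.mono (Nat.succ_le_succ hij), fun n => ℱ.le _⟩
  set W : ℕ → Ω → Vec s × Vec m := fun n ω => (θ (n + 1) ω, μ (n + 1) ω) with hWdef
  have hW : ∀ n, Measurable[ℱ' n] (W n) := fun n => by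
    obtain ⟨h1, h2⟩ := hI.measurable_iterates hModel ⟨_, hθs⟩ ⟨_, hμs⟩ (n + 1)
    exact Measurable.prodMk h1 h2
  have hT : ∀ n ω, W n ω ∈ D.Theta ×ˢ D.M := hI.mem_step
  have hY : ∀ n, Measurable[ℱ' (n + 1)] (Y (n + 1)) := fun n => hI.measurable_Y (n + 1)
  have hZ : ∀ n, Measurable[ℱ' (n + 1)] (Z (n + 1)) := fun n => hI.measurable_Z (n + 1)
  have hYm : ∀ n, Measurable (Y (n + 1)) := fun n => (hY n).mono (ℱ'.le _) le_rfl
  have hZm : ∀ n, Measurable (Z (n + 1)) := fun n => (hZ n).mono (ℱ'.le _) le_rfl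
  have hlawY : ∀ n, ∀ B : Set (Vec r), MeasurableSet B →
      Pr⟦Y (n + 1) ⁻¹' B | ℱ' n⟧ =ᵐ[Pr] fun ω => (D.samplingKernel (W n ω)).real B := fun n B hB => by
    simp_rw [samplingKernel_apply]
    exact hI.law_Y (n + 1) B hB
  have hlawZ : ∀ n, ∀ B : Set (Vec r), MeasurableSet B →
      Pr⟦Z (n + 1) ⁻¹' B | ℱ' n⟧ =ᵐ[Pr]
        fun ω => (Kernel.const (Vec s × Vec m) D.P (W n ω)).real B := fun n B hB => by
    simp_rw [Kernel.const_apply]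
    exact hI.law_Z (n + 1) B hB
  obtain ⟨K₁, hK₁⟩ := hIS.exists_moment_Gis hModel
  obtain ⟨K₂, hK₂⟩ := hIS.exists_moment_H
  have hK₂' : ∀ t ∈ D.Theta ×ˢ D.M,
      Integrable (fun y => ‖D.H t.1 t.2 y‖ ^ 2) (Kernel.const (Vec s × Vec m) D.P t) ∧
        ∫ y, ‖D.H t.1 t.2 y‖ ^ 2 ∂(Kernel.const (Vec s × Vec m) D.P t) ≤ K₂ := hK₂
  obtain ⟨B₁, hB₁⟩ := hSO.bounded.exists_norm_le
  obtain ⟨B₂, hB₂⟩ := hIS.bounded.exists_norm_le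
  have hu₁ : ∀ t ∈ D.Theta ×ˢ D.M, ‖t.1 - θs‖ ≤ 2 * B₁ := fun t ht =>
    (norm_sub_le _ _).trans (by linarith [hB₁ _ ht.1, hB₁ _ hθs])
  have hu₂ : ∀ t ∈ D.Theta ×ˢ D.M, ‖t.2 - μs‖ ≤ 2 * B₂ := fun t ht =>
    (norm_sub_le _ _).trans (by linarith [hB₂ _ ht.2, hB₂ _ hμs])
  have hGint : ∀ n ω, ∫ y, D.Gis (W n ω).1 (W n ω).2 y ∂D.samplingKernel (W n ω)
      = D.gradf (θ (n + 1) ω) := fun n ω => hModel.integral_samplingKernel_Gis (hT n ω).2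
  have hHint : ∀ n ω, ∫ y, D.H (W n ω).1 (W n ω).2 y ∂(Kernel.const (Vec s × Vec m) D.P (W n ω))
      = D.gradv (θ (n + 1) ω) (μ (n + 1) ω) := fun n ω => rfl
  have G0 := ae_summable_sq_norm hW hYm hlawY hT hModel.measurable_Gis hK₁ hsq
  have G1 := ae_tendsto_sum_inner_noise hW hY hlawY hT hModel.measurable_Gis hK₁ hsq
    (u := fun t => t.1 - θs) (measurable_fst.sub_const θs) hu₁
  have G2 := ae_tendsto_sum_noise hW hY hlawY hT hModel.measurable_Gis hK₁ hsq
  have H0 := ae_summable_sq_norm hW hZm hlawZ hT hModel.measurable_H hK₂' hsq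
  have H1 := ae_tendsto_sum_inner_noise hW hZ hlawZ hT hModel.measurable_H hK₂' hsq
    (u := fun t => t.2 - μs) (measurable_snd.sub_const μs) hu₂
  have H2 := ae_tendsto_sum_noise hW hZ hlawZ hT hModel.measurable_H hK₂' hsq
  simp only [hGint] at G1 G2
  simp only [hHint] at H1 H2
  filter_upwards [G0, G1, G2, H0, H1, H2] with ω g0 g1 g2 h0 h1 h2
  exact eventually_satisfiesPattern_of_noise hModel hSO hClass hIS hReg hSC
    (fun k => hstep (k + 1)) hsum (fun k => hI.isProj_theta k ω)
    (fun k => by rw [Finset.sum_range_succ _ (k + 1), ← sub_sub])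
    (fun k => hI.isProj_mu k ω)
    (fun k => by rw [Finset.sum_range_succ _ (k + 1), ← sub_sub]) g0 g1 g2 h0 h1 h2

end Data

end AdaptiveIS

theorem proposition1 {s r m p q : ℕ} (D : AdaptiveIS.Data s r m p q)
    (θs : AdaptiveIS.Vec s) (μs : AdaptiveIS.Vec m)
    (hModel : D.IsModel)
    (hSO : D.AssumptionSO θs)
    (hClass : D.AssumptionISClass)
    (hIS : D.AssumptionIS θs μs)
    (hReg : D.AssumptionRegularity θs μs)
    (hSC : D.AssumptionStrictCompl θs μs)
    {Ω : Type*} [mΩ : MeasurableSpace Ω] (Pr : Measure Ω) [IsProbabilityMeasure Pr]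
    (ℱ : Filtration ℕ mΩ)
    (α γ : ℝ) (hα : 0 < α) (hγ : γ ∈ Set.Ioo (1 / 2 : ℝ) 1)
    (θ₀ : AdaptiveIS.Vec s) (μ₀ : AdaptiveIS.Vec m) (hμ₀ : μ₀ ∈ D.M)
    (Y Z : ℕ → Ω → AdaptiveIS.Vec r)
    (θ : ℕ → Ω → AdaptiveIS.Vec s) (μ : ℕ → Ω → AdaptiveIS.Vec m)
    (hIter : D.IsIteration Pr ℱ (fun k => α / ((k : ℝ) + 1) ^ γ) θ₀ μ₀ Y Z θ μ) :
    ∃ N : Ω → ℕ, Measurable N ∧ ∀ᵐ ω ∂Pr, ∀ n ≥ N ω,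
      (∀ i, (D.A *ᵥ θs.ofLp) i = D.b i → (D.A *ᵥ (θ n ω).ofLp) i = D.b i) ∧
      (∀ i, (D.A *ᵥ θs.ofLp) i < D.b i → (D.A *ᵥ (θ n ω).ofLp) i < D.b i) ∧
      (∀ i, (D.C *ᵥ μs.ofLp) i = D.d i → (D.C *ᵥ (μ n ω).ofLp) i = D.d i) ∧
      (∀ i, (D.C *ᵥ μs.ofLp) i < D.d i → (D.C *ᵥ (μ n ω).ofLp) i < D.d i) := by
  have hae := AdaptiveIS.Data.IsIteration.ae_eventually_satisfiesPattern
    (step := fun k : ℕ => α / ((k : ℝ) + 1) ^ γ) hModel hSO hClass hIS hReg hSC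
    (fun k => by positivity) (AdaptiveIS.not_summable_step hα hγ.2) (AdaptiveIS.summable_step_sq hγ.1) hIter
  have hmeas := fun n => hIter.measurable_iterates hModel ⟨_, hSO.unique_minimizer.1⟩
    ⟨_, hIS.unique_minimizer.1⟩ n
  obtain ⟨N, hN, hN'⟩ := AdaptiveIS.exists_measurable_forall_ge_of_ae_eventually (Pr := Pr)
    (S := fun n => {ω | AdaptiveIS.SatisfiesPattern D.A D.b θs (θ n ω) ∧
      AdaptiveIS.SatisfiesPattern D.C D.d μs (μ n ω)})
    (fun n => (((hmeas n).1.mono (ℱ.le n) le_rfl)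
      (AdaptiveIS.measurableSet_satisfiesPattern D.A D.b θs)).inter
        (((hmeas n).2.mono (ℱ.le n) le_rfl)
          (AdaptiveIS.measurableSet_satisfiesPattern D.C D.d μs)))
    (hae.mono fun ω hω => by
      rw [eventually_atTop] at hω ⊢
      obtain ⟨k, hk⟩ := hω
      refine ⟨k + 1, fun n hn => ?_⟩
      obtain ⟨j, rfl⟩ : ∃ j, n = j + 1 := ⟨n - 1, by omega⟩
      exact hk j (by omega))
  exact ⟨N, hN, hN'.mono fun ω hω n hn => ⟨(hω n hn).1.1, (hω n hn).1.2, (hω n hn).2.1,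
    (hω n hn).2.2⟩⟩
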